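/- Let $d\ge 1$ and let $a\colon\mathbb R^d\to[0,\infty)$ be bounded, continuous, even and integrable with $\int_{\mathbb R^d}a(x)\,dx=1$. Put $(L_0u)(x)=\int_{\mathbb R^d}a(x-y)\,(u(y)-u(x))\,dy$ and $L=L_0+V$ on $L^2(\mathbb R^d)$, where $V\colon\mathbb R^d\to[0,1]$ is continuous with compact support and $V\not\equiv0$. Let $\lambda>0$ and let $\psi_\lambda$ be a principal eigenfunction of $L$ with eigenvalue $\lambda$, that is, $\psi_\lambda\in L^2(\mathbb R^d)$, $\psi_\lambda\ge0$ almost everywhere, $\psi_\lambda\ne0$ and $L\psi_\lambda=\lambda\psi_\lambda$. Then $\psi_\lambda$ has a continuous representative whenever one of the conditions below on $a$ holds, and, for this representative: 1. If, for some $\alpha>0$, $c_->0$ and $c_+$, $c_-(1+|x|)^{-(d+\alpha)}\le a(x)\le c_+(1+|x|)^{-(d+\alpha)}$ for all $x\in\mathbb R^d$, then there are constants $0<\tilde c_-(\lambda)\le\tilde c_+(\lambda)$ with $$\tilde c_-(\lambda)(1+|x|)^{-(d+\alpha)}\le\psi_\lambda(x)\le\tilde c_+(\lambda)(1+|x|)^{-(d+\alpha)}\qquad\text{for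 all }x\in\mathbb R^d.$$ 2. If $a(x)\le c\,e^{-\delta|x|}$ for all $x\in\mathbb R^d$, with constants $c$ and $\delta>0$, then there are $m(\lambda)>0$, depending only on $a$ and $\lambda$, and $K(\lambda)>0$ with $$\psi_\lambda(x)\le K(\lambda)\,e^{-m(\lambda)|x|}\qquad\text{for all }x\in\mathbb R^d.$$ 3. Let $d=1$ and $\lim_{|x|\to\infty}\frac{\ln a(x)}{|x|}=-c$ with a constant $c>0$, and put $\tilde a(p)=\int_{\mathbb R}e^{-ipx}a(x)\,dx$ for $|\operatorname{Im}p|<c$. - If $\tilde a(iq)=1+\lambda$ for some $q=q(\lambda)\in(0,c)$, then there are constants $C_+(\lambda),C_-(\lambda)>0$ with $$\psi_\lambda(x)=e^{-q(\lambda)|x|}\bigl(C_\pm(\lambda)+o(1)\bigr)\qquad\text{as }x\to\pm\infty,$$ and $C_+(\lambda)=C_-(\lambda)$ if $V$ is even. - If there is no $q\in(0,c)$ with $\tilde a(iq)=1+\lambda$, then for every $\varepsilon>0$ there are constants $C_1,C_2>0$, which may depend on $\lambda$ and $\varepsilon$, with $$C_1\,e^{-(c+\varepsilon)|x|}\le\psi_\lambda(x)\le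 C_2\,e^{-(c-\varepsilon)|x|}\qquad\text{for all }x\in\mathbb R.$$ The constants other than $m(\lambda)$, $q(\lambda)$ may also depend on $a$, $V$ and $\psi_\lambda$. -/

import Mathlib

open MeasureTheory Filter Topology

noncomputable section

/-- The standing assumptions on the dispersal kernel: nonnegative, bounded, even, continuous,
integrable, of unit mass. -/
structure IsDispersalKernel {E : Type*} [NormedAddCommGroup E] [MeasureSpace E]
    (a : E → ℝ) : Prop where
  continuous : Continuous a
  bounded : ∃ M : ℝ, ∀ x, a x ≤ M
  nonneg : ∀ x, 0 ≤ a x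
  even : ∀ x, a (-x) = a x
  integrable : Integrable a volume
  integral_eq_one : ∫ x, a x = 1

/-- The standing assumptions on the potential: continuous, compactly supported, with values in
`[0, 1]`, and not identically zero. -/
structure IsPotential {E : Type*} [NormedAddCommGroup E] (V : E → ℝ) : Prop where
  continuous : Continuous V
  hasCompactSupport : HasCompactSupport V
  nonneg : ∀ x, 0 ≤ V x
  le_one : ∀ x, V x ≤ 1
  ne_zero : V ≠ 0

/-- The convolution type operator `(L₀ u)(x) = ∫ a(x - y) (u(y) - u(x)) dy`. -/
def nonlocalOp {E : Type*} [NormedAddCommGroup E] [MeasureSpace E]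
    (a : E → ℝ) (u : E → ℝ) (x : E) : ℝ :=
  ∫ y, a (x - y) * (u y - u x)

/-- The perturbed operator `L = L₀ + V`. -/
def schrodingerOp {E : Type*} [NormedAddCommGroup E] [MeasureSpace E]
    (a V : E → ℝ) (u : E → ℝ) (x : E) : ℝ :=
  nonlocalOp a u x + V x * u x

/-- `ψ` is a principal eigenfunction (ground state) of `L = L₀ + V` in `L²` with eigenvalue `lam`:
a nonzero, almost everywhere nonnegative element of `L²` with `L ψ = lam ψ` almost everywhere.
Only the sign is prescribed, not that `lam` is the top of the spectrum: for `lam > 0` no other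
eigenvalue has a nonnegative eigenfunction. -/
structure IsPrincipalEigenfunction {E : Type*} [NormedAddCommGroup E] [MeasureSpace E]
    (a V : E → ℝ) (lam : ℝ) (ψ : E → ℝ) : Prop where
  memLp : MemLp ψ 2 volume
  nonneg : ∀ᵐ x, 0 ≤ ψ x
  ne_zero : ¬ (∀ᵐ x, ψ x = 0)
  eigen : ∀ᵐ x, schrodingerOp a V ψ x = lam * ψ x

/-- The Fourier transform `ã(p) = ∫ e^{-ipx} a(x) dx` of a kernel on the line, at complex
arguments `p`; thus `ã(iq) = ∫ e^{qx} a(x) dx`. -/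
def kernelTransform (a : ℝ → ℝ) (p : ℂ) : ℂ :=
  ∫ x : ℝ, Complex.exp (-(Complex.I * p * (x : ℂ))) * (a x : ℂ)

end

/-! Solving the eigenvalue equation for `ψ` gives `ψ = (a * ψ) / (1 + lam - V)`. The denominator is
at least `lam`, and a convolution of two square integrable functions is continuous and bounded. The
right-hand side is therefore a continuous representative that solves `(1 + lam) u = a * u + V u` at
every point.

Off the support of `V` the equation reads `(1 + lam) u = a * u`, where `a` averages with mass one. A
positive `W` with `a * W ≤ (1 + lam) W` thus dominates `u` up to a constant
(`le_mul_supersolution`). Upper bounds reduce to finding supersolutions: `(1 + ε‖x‖) ^ (-s)` with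
`ε` small for polynomial tails, `exp (-m‖x‖)` with `m` small for exponential tails, and `exp (-q x)`
on the line, an exact eigenfunction of the convolution with eigenvalue `∫ a(x) exp (q x)`. Lower
bounds come from `u ≥ (a * u) / (1 + lam)`, keeping only a ball on which `u` is bounded below
(`exists_lower_bound`).

For the exact asymptotics let `∫ a(x) exp (q x) = 1 + lam`. Then `p(y) = a(y) exp (q y) / (1 + lam)`
is a probability density, and `h(x) = exp (q x) u(x)` solves `h - p * h = g` with a compactly
supported source `g ≥ 0`. The flux `∫ p(y) ∫₀^y h(x - t) dt dy` has derivative `g`; it vanishes far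
to the left and equals the constant `∫ g > 0` far to the right. Along a sequence realizing `limsup
h` all translates of `h` converge to the same value, so the flux determines that value. The same
holds for `-h`, hence `h` converges. Reflection treats the other end, and uniqueness up to a factor
gives equal constants when `V` is even. -/

theorem IsDispersalKernel.memLp_two {E : Type*} [NormedAddCommGroup E]
    [MeasureSpace E] [BorelSpace E] {a : E → ℝ} (ha : IsDispersalKernel a) :
    MemLp a 2 volume := by
  obtain ⟨M, hM⟩ := ha.bounded
  rw [memLp_two_iff_integrable_sq ha.continuous.aestronglyMeasurable]
  refine (ha.integrable.const_mul M).mono' (by have := ha.continuous; fun_prop) ?_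
  refine Eventually.of_forall fun x => ?_
  rw [Real.norm_of_nonneg (sq_nonneg _), sq]
  exact mul_le_mul_of_nonneg_right (hM x) (ha.nonneg x)

/-! ### Continuous representative, maximum principle and comparison. -/

section General

variable {E : Type*} [NormedAddCommGroup E] [NormedSpace ℝ E] [FiniteDimensional ℝ E]
  [MeasureSpace E] [BorelSpace E] [(volume : Measure E).IsAddHaarMeasure]

theorem IsDispersalKernel.integrable_comp_sub {a : E → ℝ} (ha : IsDispersalKernel a) (x : E) :
    Integrable (fun y => a (x - y)) :=
  ha.integrable.comp_sub_left x

theorem IsDispersalKernel.integral_comp_sub {a : E → ℝ} (ha : IsDispersalKernel a) (x : E) :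
    ∫ y, a (x - y) = 1 := by
  rw [integral_sub_left_eq_self]; exact ha.integral_eq_one

theorem IsDispersalKernel.integrable_mul_of_memLp {a : E → ℝ} (ha : IsDispersalKernel a)
    {u : E → ℝ} (hu : MemLp u 2 volume) (x : E) : Integrable (fun y => a (x - y) * u y) :=
  MemLp.integrable_mul (p := 2) (q := 2)
    (ha.memLp_two.comp_measurePreserving (Measure.measurePreserving_sub_left volume x)) hu

theorem IsDispersalKernel.integrable_mul_of_bounded {a : E → ℝ} (ha : IsDispersalKernel a)
    {u : E → ℝ} (hu : Continuous u) {B : ℝ} (hB : ∀ y, |u y| ≤ B) (x : E) :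
    Integrable (fun y => a (x - y) * u y) :=
  (ha.integrable_comp_sub x).mul_bdd (c := B) hu.aestronglyMeasurable
    (Eventually.of_forall hB)

/-- The convolution of a dispersal kernel with a square integrable function is continuous and
bounded. -/
theorem IsDispersalKernel.continuous_bounded_conv {a : E → ℝ} (ha : IsDispersalKernel a)
    {u : E → ℝ} (hu : MemLp u 2 volume) :
    Continuous (fun x => ∫ y, a (x - y) * u y) ∧ ∃ B, ∀ x, |∫ y, a (x - y) * u y| ≤ B := by
  set A : Lp ℝ 2 (volume : Measure E) := ha.memLp_two.toLp a
  set U : Lp ℝ 2 (volume : Measure E) := hu.toLp u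
  have : Fact ((2 : ENNReal) ≠ ⊤) := ⟨by norm_num⟩
  -- Evenness turns `a (x - y)` into a translate of `a`, so the convolution is an `L²` inner product
  -- with that translate. Continuity follows from strong continuity of translations and boundedness
  -- from Cauchy–Schwarz.
  have key : ∀ x : E, ∫ y, a (x - y) * u y = inner ℝ U ((DomAddAct.mk (-x)) +ᵥ A) := by
    intro x
    rw [L2.inner_def]
    refine integral_congr_ae ?_
    have h1 := DomAddAct.vadd_Lp_ae_eq (DomAddAct.mk (-x)) A
    have h2 : (fun y => A (-x + y)) =ᵐ[volume] fun y => a (-x + y) :=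
      (measurePreserving_add_left volume (-x)).quasiMeasurePreserving.ae_eq_comp
        ha.memLp_two.coeFn_toLp
    filter_upwards [h1, h2, hu.coeFn_toLp] with y e1 e2 e3
    have e4 : a (x - y) = a (-x + y) := by rw [← ha.even]; congr 1; abel
    simp only [U]
    rw [e1, e3, e4]
    simp only [Equiv.symm_apply_apply, vadd_eq_add, e2]
    simp
  simp only [key]
  constructor
  · have : Continuous fun x : E => (DomAddAct.mk (-x)) +ᵥ A := by
      have h : Continuous fun x : E => DomAddAct.mk (-x) :=
        DomAddAct.continuous_mk.comp continuous_neg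
      exact h.vadd continuous_const
    exact continuous_const.inner this
  · refine ⟨‖U‖ * ‖A‖, fun x => ?_⟩
    have := norm_inner_le_norm (𝕜 := ℝ) U ((DomAddAct.mk (-x)) +ᵥ A)
    rwa [DomAddAct.norm_vadd_Lp] at this

/-- A nonzero nonnegative bounded continuous function with `L u = lam u` everywhere. -/
structure IsStationarySolution (a V : E → ℝ) (lam : ℝ) (u : E → ℝ) : Prop where
  continuous : Continuous u
  nonneg : ∀ x, 0 ≤ u x
  bounded : ∃ B, ∀ x, u x ≤ B
  exists_pos : ∃ x, 0 < u x
  eq : ∀ x, (1 + lam) * u x = (∫ y, a (x - y) * u y) + V x * u x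

theorem IsStationarySolution.integrable_mul {a V u : E → ℝ} {lam : ℝ} (hu : IsStationarySolution a V lam u)
    (ha : IsDispersalKernel a) (x : E) : Integrable (fun y => a (x - y) * u y) := by
  obtain ⟨B, hB⟩ := hu.bounded
  exact ha.integrable_mul_of_bounded hu.continuous
    (fun y => by rw [abs_of_nonneg (hu.nonneg y)]; exact hB y) x

/-- The representative is `(a * ψ) / (1 + lam - V)`. It equals `ψ` almost everywhere, and the
convolution does not see null sets, so the equation then holds at every point. -/
theorem IsPrincipalEigenfunction.exists_isStationarySolution {a V ψ : E → ℝ} {lam : ℝ} (hlam : 0 < lam)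
    (ha : IsDispersalKernel a) (hV : IsPotential V) (hψ : IsPrincipalEigenfunction a V lam ψ) :
    ∃ u, u =ᵐ[volume] ψ ∧ IsStationarySolution a V lam u := by
  obtain ⟨hc, B, hB⟩ := ha.continuous_bounded_conv hψ.memLp
  have hden : ∀ x, lam ≤ 1 + lam - V x := fun x => by linarith [hV.le_one x]
  have hden' : ∀ x, 0 < 1 + lam - V x := fun x => hlam.trans_le (hden x)
  have hae : (fun x => (∫ y, a (x - y) * ψ y) / (1 + lam - V x)) =ᵐ[volume] ψ := by
    filter_upwards [hψ.eigen] with x hx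
    have h1 : nonlocalOp a ψ x = (∫ y, a (x - y) * ψ y) - ψ x := by
      unfold nonlocalOp
      simp only [mul_sub]
      rw [integral_sub (ha.integrable_mul_of_memLp hψ.memLp x)
        ((ha.integrable_comp_sub x).mul_const _), integral_mul_const, ha.integral_comp_sub, one_mul]
    rw [schrodingerOp, h1] at hx
    rw [div_eq_iff (hden' x).ne']
    linarith
  have hnn : ∀ x, 0 ≤ ∫ y, a (x - y) * ψ y := fun x =>
    integral_nonneg_of_ae (by filter_upwards [hψ.nonneg] with y hy using mul_nonneg (ha.nonneg _) hy)
  refine ⟨_, hae, ?_, fun x => div_nonneg (hnn x) (hden' x).le, ⟨B / lam, fun x => ?_⟩, ?_,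
    fun x => ?_⟩
  · exact hc.div (continuous_const.sub hV.continuous) fun x => (hden' x).ne'
  · exact div_le_div₀ ((abs_nonneg _).trans (hB x)) ((le_abs_self _).trans (hB x)) hlam (hden x)
  · by_contra! h
    refine hψ.ne_zero ?_
    filter_upwards [hae] with x hx
    rw [← hx]
    exact le_antisymm (h x) (div_nonneg (hnn x) (hden' x).le)
  · have : ∫ y, a (x - y) * ((∫ z, a (y - z) * ψ z) / (1 + lam - V y)) = ∫ y, a (x - y) * ψ y :=
      integral_congr_ae (by filter_upwards [hae] with y hy; rw [hy])
    rw [this]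
    have := (hden' x).ne'
    field_simp
    ring

/-- Maximum principle outside a set. -/
theorem nonpos_of_subsolution {a w : E → ℝ} {lam : ℝ} (hlam : 0 < lam) (ha : IsDispersalKernel a)
    {K : Set E} (hbdd : ∃ B, ∀ x, w x ≤ B) (hK : ∀ x ∈ K, w x ≤ 0)
    (hint : ∀ x ∉ K, Integrable (fun y => a (x - y) * w y))
    (hsub : ∀ x ∉ K, (1 + lam) * w x ≤ ∫ y, a (x - y) * w y) (x : E) : w x ≤ 0 := by
  obtain ⟨B, hB⟩ := hbdd
  have hbd : BddAbove (Set.range fun x => max (w x) 0) :=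
    ⟨max B 0, by rintro _ ⟨x, rfl⟩; exact max_le_max_right _ (hB x)⟩
  set S := ⨆ x, max (w x) 0
  have hwS : ∀ x, w x ≤ S := fun x => (le_max_left _ _).trans (le_ciSup hbd x)
  have hS0 : 0 ≤ S := (le_max_right (w 0) 0).trans (le_ciSup hbd 0)
  -- Since `a` has mass one, averaging cannot exceed `S`, the supremum of the positive part. The
  -- factor `1 + lam > 1` then forces `S = 0`, without attained maxima or decay at infinity.
  have h1 : ∀ x, w x ≤ S / (1 + lam) := by
    intro x
    by_cases hx : x ∈ K
    · exact (hK x hx).trans (by positivity)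
    rw [le_div_iff₀ (by linarith), mul_comm]
    refine (hsub x hx).trans ?_
    calc ∫ y, a (x - y) * w y ≤ ∫ y, a (x - y) * S :=
          integral_mono (hint x hx) ((ha.integrable_comp_sub x).mul_const _)
            fun y => mul_le_mul_of_nonneg_left (hwS y) (ha.nonneg _)
      _ = S := by rw [integral_mul_const, ha.integral_comp_sub, one_mul]
  have h2 : S ≤ S / (1 + lam) := ciSup_le fun x => max_le (h1 x) (by positivity)
  rw [le_div_iff₀ (by linarith)] at h2
  have : S = 0 := by nlinarith
  exact this ▸ hwS x

/-- A positive supersolution of the unperturbed equation dominates stationary functions. -/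
theorem IsStationarySolution.le_mul_supersolution {a V u W : E → ℝ} {lam : ℝ} (hlam : 0 < lam)
    (ha : IsDispersalKernel a) (hV : IsPotential V) (hu : IsStationarySolution a V lam u)
    (hW : Continuous W) (hpos : ∀ x, 0 < W x) (hint : ∀ x, Integrable (fun y => a (x - y) * W y))
    (hsup : ∀ x, ∫ y, a (x - y) * W y ≤ (1 + lam) * W x) :
    ∃ M, 0 < M ∧ ∀ x, u x ≤ M * W x := by
  -- `M` bounds `u / W` on the compact support of `V`; off it `V` vanishes and `u - max M 1 * W` is
  -- a subsolution.
  obtain ⟨M, hM⟩ := hV.hasCompactSupport.isCompact.bddAbove_image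
    (f := fun x => u x / W x) (hu.continuous.div hW fun x => (hpos x).ne').continuousOn
  refine ⟨max M 1, by positivity, fun x => ?_⟩
  obtain ⟨B, hB⟩ := hu.bounded
  have hM0 : 0 ≤ max M 1 := by positivity
  have hmul : ∀ x, ∀ y, a (x - y) * (u y - max M 1 * W y)
      = a (x - y) * u y - max M 1 * (a (x - y) * W y) := fun x y => by ring
  have := nonpos_of_subsolution (w := fun x => u x - max M 1 * W x) (K := tsupport V) hlam ha
    ⟨B, fun x => by have := mul_nonneg hM0 (hpos x).le; linarith [hB x]⟩
    (fun x hx => by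
      have h := (div_le_iff₀ (hpos x)).1 (hM ⟨x, hx, rfl⟩)
      have := mul_le_mul_of_nonneg_right (le_max_left M 1) (hpos x).le
      linarith)
    (fun x _ => by
      simp only [hmul]
      exact (hu.integrable_mul ha x).sub ((hint x).const_mul _))
    (fun x hx => by
      simp only [hmul]
      rw [integral_sub (hu.integrable_mul ha x) ((hint x).const_mul _), integral_const_mul]
      have h1 := hu.eq x
      rw [image_eq_zero_of_notMem_tsupport hx, zero_mul, add_zero] at h1
      have := mul_le_mul_of_nonneg_left (hsup x) hM0
      linarith) x
  simpa using this

/-- A stationary function is bounded below by local lower bounds of the kernel. -/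
theorem IsStationarySolution.exists_lower_bound {a V u : E → ℝ} {lam : ℝ} (hlam : 0 < lam)
    (ha : IsDispersalKernel a) (hV : IsPotential V) (hu : IsStationarySolution a V lam u) :
    ∃ κ R : ℝ, 0 < κ ∧ 0 < R ∧ ∀ x b, (∀ z, ‖z - x‖ ≤ R → b ≤ a z) → κ * b ≤ u x := by
  obtain ⟨x₀, hx₀⟩ := hu.exists_pos
  have hnhds : {y | u x₀ / 2 < u y} ∈ 𝓝 x₀ :=
    (isOpen_lt continuous_const hu.continuous).mem_nhds (half_lt_self hx₀)
  obtain ⟨r, hr, hball⟩ := Metric.mem_nhds_iff.1 hnhds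
  have hvol : 0 < volume.real (Metric.ball x₀ r) :=
    ENNReal.toReal_pos (Metric.measure_ball_pos _ _ hr).ne' measure_ball_lt_top.ne
  -- Every `y` in the ball around `x₀` has norm at most `‖x₀‖ + r`, so `x - y` lies within `R` of
  -- `x`. The constant is the lower bound of `u` on the ball times its volume, divided by `1 + lam`.
  refine ⟨u x₀ / 2 * volume.real (Metric.ball x₀ r) / (1 + lam), ‖x₀‖ + r, by positivity,
    by positivity, fun x b hb => ?_⟩
  rw [div_mul_eq_mul_div, div_le_iff₀ (by linarith)]
  have hint := hu.integrable_mul ha x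
  rcases le_or_gt b 0 with hb0 | hb0
  · exact (mul_nonpos_of_nonneg_of_nonpos (by positivity) hb0).trans
      (mul_nonneg (hu.nonneg x) (by linarith))
  calc u x₀ / 2 * volume.real (Metric.ball x₀ r) * b
      = ∫ y in Metric.ball x₀ r, b * (u x₀ / 2) := by
        rw [setIntegral_const, smul_eq_mul]; ring
    _ ≤ ∫ y in Metric.ball x₀ r, a (x - y) * u y := by
        refine setIntegral_mono_on ?_ hint.integrableOn measurableSet_ball fun y hy => ?_
        · exact integrableOn_const measure_ball_lt_top.ne
        · have h1 : b ≤ a (x - y) := hb _ (by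
            have : ‖y‖ ≤ ‖x₀‖ + r := by
              have := norm_add_le x₀ (y - x₀)
              rw [add_sub_cancel] at this
              have h3 := mem_ball_iff_norm.1 hy
              linarith
            simpa using this)
          have h2 : u x₀ / 2 ≤ u y := (hball hy).le
          exact mul_le_mul h1 h2 (by positivity) (ha.nonneg _)
    _ ≤ ∫ y, a (x - y) * u y :=
        setIntegral_le_integral hint (Eventually.of_forall fun y =>
          mul_nonneg (ha.nonneg _) (hu.nonneg y))
    _ ≤ u x * (1 + lam) := by
        have := hu.eq x
        have := mul_nonneg (hV.nonneg x) (hu.nonneg x)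
        linarith

end General

/-! ### Polynomial weights. -/

theorem rpow_neg_le_mul_rpow_neg {A B C s : ℝ} (hA : 0 < A) (hB : 0 < B) (hC : 0 < C)
    (hs : 0 ≤ s) (h : B ≤ C * A) : A ^ (-s) ≤ C ^ s * B ^ (-s) := by
  have h1 : B ^ s ≤ C ^ s * A ^ s := by
    rw [← Real.mul_rpow hC.le hA.le]
    exact Real.rpow_le_rpow hB.le h hs
  rw [Real.rpow_neg hA.le, Real.rpow_neg hB.le, ← div_eq_mul_inv,
    le_div_iff₀ (by positivity), inv_mul_eq_div, div_le_iff₀ (by positivity)]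
  exact h1

/-- Pointwise splitting of the convolution of a polynomially decaying kernel with a slowly
varying weight. -/
theorem mul_one_add_mul_norm_rpow_le {E : Type*} [NormedAddCommGroup E]
    [MeasureSpace E] {a : E → ℝ} (ha : IsDispersalKernel a) {s cp ε η : ℝ}
    (hs : 0 < s) (hε : 0 < ε) (hη : 0 < η) (hcp : 0 ≤ cp)
    (hle : ∀ x, a x ≤ cp * (1 + ‖x‖) ^ (-s)) (x z : E) :
    a z * (1 + ε * ‖x - z‖) ^ (-s) ≤ ((1 + η) ^ s * a z
      + 2 ^ s * {z : E | η / ε < ‖z‖}.indicator a z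
      + cp * (ε * (2 + 1 / η)) ^ s * (1 + ε * ‖x - z‖) ^ (-s)) * (1 + ε * ‖x‖) ^ (-s) := by
  have haz := ha.nonneg z
  have hA : 0 < 1 + ε * ‖x - z‖ := by positivity
  have hB : 0 < 1 + ε * ‖x‖ := by positivity
  have hW : 0 ≤ (1 + ε * ‖x‖) ^ (-s) := by positivity
  have hW' : 0 ≤ (1 + ε * ‖x - z‖) ^ (-s) := by positivity
  have t1 : 0 ≤ (1 + η) ^ s * a z := by positivity
  have t2 : 0 ≤ 2 ^ s * {z : E | η / ε < ‖z‖}.indicator a z :=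
    mul_nonneg (by positivity) (Set.indicator_nonneg (fun y _ => ha.nonneg y) z)
  have t3 : 0 ≤ cp * (ε * (2 + 1 / η)) ^ s * (1 + ε * ‖x - z‖) ^ (-s) := by positivity
  -- Three regimes. For `‖z‖ ≤ η / ε` the weight changes by at most `(1 + η) ^ s`. For larger `z`
  -- with `‖x - z‖ ≥ ‖x‖ / 2` it changes by at most `2 ^ s`, but `z` is in the tail of `a`.
  -- Otherwise `‖z‖ > ‖x‖ / 2`, and the decay of the kernel itself supplies the weight at `x`, with
  -- a factor of order `ε ^ s`.
  have htri : ‖x‖ ≤ ‖x - z‖ + ‖z‖ := by simpa using norm_add_le (x - z) z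
  rcases le_or_gt ‖z‖ (η / ε) with hz | hz
  · have h1 := rpow_neg_le_mul_rpow_neg (C := 1 + η) hA hB (by positivity) hs.le (by
      rw [le_div_iff₀ hε] at hz
      have : 0 ≤ η * (ε * ‖x - z‖) := by positivity
      nlinarith)
    calc _ ≤ a z * ((1 + η) ^ s * (1 + ε * ‖x‖) ^ (-s)) := mul_le_mul_of_nonneg_left h1 haz
      _ = (1 + η) ^ s * a z * (1 + ε * ‖x‖) ^ (-s) := by ring
      _ ≤ _ := mul_le_mul_of_nonneg_right (by linarith) hW
  have hind : {z : E | η / ε < ‖z‖}.indicator a z = a z :=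
    Set.indicator_of_mem (show z ∈ {z : E | η / ε < ‖z‖} from hz) a
  rcases le_or_gt (‖x‖ / 2) ‖x - z‖ with hxz | hxz
  · have h1 := rpow_neg_le_mul_rpow_neg (C := 2) hA hB (by positivity) hs.le (by nlinarith)
    calc _ ≤ a z * (2 ^ s * (1 + ε * ‖x‖) ^ (-s)) := mul_le_mul_of_nonneg_left h1 haz
      _ = 2 ^ s * {z : E | η / ε < ‖z‖}.indicator a z * (1 + ε * ‖x‖) ^ (-s) := by
        rw [hind]; ring
      _ ≤ _ := mul_le_mul_of_nonneg_right (by linarith) hW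
  · have h1 := rpow_neg_le_mul_rpow_neg (A := 1 + ‖z‖) (C := ε * (2 + 1 / η)) (by positivity) hB
      (by positivity) hs.le (by
        rw [div_lt_iff₀ hε] at hz
        have h2 : 1 ≤ ε * ‖z‖ / η := by rw [one_le_div hη]; linarith
        have h3 : ε * (2 + 1 / η) * (1 + ‖z‖)
          = ε * ‖z‖ / η + 2 * ε * ‖z‖ + ε * (2 + 1 / η) := by field_simp; ring
        have h4 : 0 ≤ ε * (2 + 1 / η) := by positivity
        nlinarith)
    calc _ ≤ (cp * (1 + ‖z‖) ^ (-s)) * (1 + ε * ‖x - z‖) ^ (-s) :=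
          mul_le_mul_of_nonneg_right (hle z) hW'
      _ ≤ (cp * ((ε * (2 + 1 / η)) ^ s * (1 + ε * ‖x‖) ^ (-s))) * (1 + ε * ‖x - z‖) ^ (-s) := by
          gcongr
      _ = cp * (ε * (2 + 1 / η)) ^ s * (1 + ε * ‖x - z‖) ^ (-s) * (1 + ε * ‖x‖) ^ (-s) := by ring
      _ ≤ _ := mul_le_mul_of_nonneg_right (by linarith) hW

/-! ### Exponential and polynomial bounds in any dimension. -/

section Decay

variable {E : Type*} [NormedAddCommGroup E] [NormedSpace ℝ E] [FiniteDimensional ℝ E]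
  [MeasureSpace E] [BorelSpace E] [(volume : Measure E).IsAddHaarMeasure]

theorem integrable_exp_neg_mul_norm {η : ℝ} (hη : 0 < η) :
    Integrable (fun x : E => Real.exp (-(η * ‖x‖))) := by
  set k : ℕ := Module.finrank ℝ E + 1
  have h1 : Integrable (fun x : E => (1 + ‖x‖) ^ (-(k : ℝ))) :=
    integrable_one_add_norm (by simp [k])
  refine (h1.const_mul (k.factorial * Real.exp η / η ^ k)).mono'
    (by fun_prop) (Eventually.of_forall fun x => ?_)
  have hx : 0 < 1 + ‖x‖ := by positivity
  rw [Real.norm_of_nonneg (Real.exp_pos _).le, Real.rpow_neg hx.le, Real.rpow_natCast]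
  have h2 := Real.pow_div_factorial_le_exp (x := η * (1 + ‖x‖)) (by positivity) k
  rw [div_le_iff₀ (by positivity), mul_pow] at h2
  rw [Real.exp_neg, ← div_eq_mul_inv, le_div_iff₀ (by positivity), le_div_iff₀ (by positivity),
    inv_mul_eq_div, div_mul_eq_mul_div, div_le_iff₀ (by positivity)]
  calc (1 + ‖x‖) ^ k * η ^ k = η ^ k * (1 + ‖x‖) ^ k := mul_comm _ _
    _ ≤ _ := h2
    _ = _ := by rw [mul_add, mul_one, Real.exp_add]; ring

theorem IsDispersalKernel.integrable_mul_exp_norm {a : E → ℝ} (ha : IsDispersalKernel a)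
    {c δ m : ℝ} (hm : m < δ) (hle : ∀ x, a x ≤ c * Real.exp (-(δ * ‖x‖))) :
    Integrable (fun x => a x * Real.exp (m * ‖x‖)) := by
  refine ((integrable_exp_neg_mul_norm (E := E) (sub_pos.2 hm)).const_mul c).mono'
    (ha.continuous.mul (by fun_prop)).aestronglyMeasurable (Eventually.of_forall fun x => ?_)
  rw [Real.norm_of_nonneg (mul_nonneg (ha.nonneg x) (Real.exp_pos _).le)]
  calc a x * Real.exp (m * ‖x‖) ≤ c * Real.exp (-(δ * ‖x‖)) * Real.exp (m * ‖x‖) :=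
        mul_le_mul_of_nonneg_right (hle x) (Real.exp_pos _).le
    _ = _ := by rw [mul_assoc, ← Real.exp_add]; congr 2; ring

/-- As `m → 0` the moment tends to the mass `1 < 1 + lam`, with the moment of rate `δ / 2` as
dominating function. Neither `V` nor `ψ` enters the choice of `m`. -/
theorem IsDispersalKernel.exists_exp_moment_le {a : E → ℝ} (ha : IsDispersalKernel a)
    {c δ lam : ℝ} (hlam : 0 < lam) (hδ : 0 < δ)
    (hle : ∀ x, a x ≤ c * Real.exp (-(δ * ‖x‖))) :
    ∃ m, 0 < m ∧ m < δ ∧ ∫ x, a x * Real.exp (m * ‖x‖) ≤ 1 + lam := by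
  have hlim : Tendsto (fun m : ℝ => ∫ x, a x * Real.exp (m * ‖x‖)) (𝓝[>] 0) (𝓝 (∫ x, a x)) := by
    refine tendsto_integral_filter_of_dominated_convergence
      (fun x => a x * Real.exp (δ / 2 * ‖x‖)) (Eventually.of_forall fun m => ?_) ?_
      (ha.integrable_mul_exp_norm (by linarith) hle) (Eventually.of_forall fun x => ?_)
    · exact (ha.continuous.mul (by fun_prop)).aestronglyMeasurable
    · have h : ∀ᶠ m : ℝ in 𝓝[>] 0, m < δ / 2 :=
        nhdsWithin_le_nhds (eventually_lt_nhds (by linarith))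
      filter_upwards [h] with m hm
      refine Eventually.of_forall fun x => ?_
      rw [Real.norm_of_nonneg (mul_nonneg (ha.nonneg x) (Real.exp_pos _).le)]
      have := ha.nonneg x
      gcongr
    · have : Tendsto (fun m : ℝ => a x * Real.exp (m * ‖x‖)) (𝓝 0)
          (𝓝 (a x * Real.exp (0 * ‖x‖))) := by
        apply Continuous.tendsto (f := fun m : ℝ => a x * Real.exp (m * ‖x‖))
        fun_prop
      simpa using this.mono_left nhdsWithin_le_nhds
  rw [ha.integral_eq_one] at hlim
  have h1 : ∀ᶠ m : ℝ in 𝓝[>] 0, m < δ := nhdsWithin_le_nhds (eventually_lt_nhds hδ)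
  obtain ⟨m, h2, h3, h4⟩ := ((hlim.eventually (eventually_lt_nhds (lt_add_of_pos_right 1 hlam))).and
    (h1.and self_mem_nhdsWithin)).exists
  exact ⟨m, h4, h3, h2.le⟩

/-- By the triangle inequality `exp (-m‖y‖) ≤ exp (m‖x - y‖) exp (-m‖x‖)`, so the moment bound makes
`exp (-m‖x‖)` a supersolution. -/
theorem IsStationarySolution.exists_le_exp_norm {a V u : E → ℝ} {lam m : ℝ} (hlam : 0 < lam)
    (ha : IsDispersalKernel a) (hV : IsPotential V) (hu : IsStationarySolution a V lam u)
    (hm : 0 < m) (hint : Integrable fun x => a x * Real.exp (m * ‖x‖))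
    (hle : ∫ x, a x * Real.exp (m * ‖x‖) ≤ 1 + lam) :
    ∃ K, 0 < K ∧ ∀ x, u x ≤ K * Real.exp (-(m * ‖x‖)) := by
  have hint' : ∀ x, Integrable (fun y => a (x - y) * Real.exp (-(m * ‖y‖))) := fun x =>
    ha.integrable_mul_of_bounded (by fun_prop) (B := 1) (fun y => by
      rw [abs_of_pos (Real.exp_pos _), Real.exp_le_one_iff]
      have : 0 ≤ m * ‖y‖ := by positivity
      linarith) x
  refine hu.le_mul_supersolution hlam ha hV (by fun_prop) (fun x => Real.exp_pos _) hint'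
    fun x => ?_
  calc ∫ y, a (x - y) * Real.exp (-(m * ‖y‖))
      ≤ ∫ y, a (x - y) * Real.exp (m * ‖x - y‖) * Real.exp (-(m * ‖x‖)) := by
        refine integral_mono (hint' x) ((hint.comp_sub_left x).mul_const _) fun y => ?_
        simp only []
        rw [mul_assoc, ← Real.exp_add]
        refine mul_le_mul_of_nonneg_left (Real.exp_le_exp.2 ?_) (ha.nonneg _)
        have := norm_sub_norm_le x y
        nlinarith
    _ = (∫ y, a y * Real.exp (m * ‖y‖)) * Real.exp (-(m * ‖x‖)) := by
        rw [integral_mul_const, integral_sub_left_eq_self (fun y => a y * Real.exp (m * ‖y‖))]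
    _ ≤ _ := mul_le_mul_of_nonneg_right hle (Real.exp_pos _).le

theorem integrable_one_add_mul_norm_rpow {s ε : ℝ} (hs : (Module.finrank ℝ E : ℝ) < s)
    (hε : 0 < ε) : Integrable (fun x : E => (1 + ε * ‖x‖) ^ (-s)) := by
  have := (integrable_one_add_norm (E := E) (μ := volume) hs).comp_smul hε.ne'
  simpa [norm_smul, abs_of_pos hε] using this

theorem integral_one_add_mul_norm_rpow {s ε : ℝ} (hε : 0 < ε) :
    ∫ x : E, (1 + ε * ‖x‖) ^ (-s) =
      ε ^ (-(Module.finrank ℝ E : ℝ)) * ∫ x : E, (1 + ‖x‖) ^ (-s) := by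
  have := Measure.integral_comp_smul_of_nonneg (volume : Measure E)
    (fun x => (1 + ‖x‖) ^ (-s)) ε (hR := hε.le)
  simpa [norm_smul, abs_of_pos hε, Real.rpow_neg hε.le] using this

/-- Slowly varying polynomial weights are supersolutions for polynomially decaying kernels. -/
theorem IsDispersalKernel.exists_polynomial_supersolution {a : E → ℝ} (ha : IsDispersalKernel a)
    {s cp lam : ℝ} (hlam : 0 < lam) (hs : (Module.finrank ℝ E : ℝ) < s)
    (hle : ∀ x, a x ≤ cp * (1 + ‖x‖) ^ (-s)) :
    ∃ ε, 0 < ε ∧ ∀ x, ∫ y, a (x - y) * (1 + ε * ‖y‖) ^ (-s) ≤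
      (1 + lam) * (1 + ε * ‖x‖) ^ (-s) := by
  have hs0 : 0 < s := (Nat.cast_nonneg _).trans_lt hs
  have hcp : 0 ≤ cp := by simpa using (ha.nonneg 0).trans (hle 0)
  -- `η` is fixed before `ε`. The near part may use half of the margin `lam`; the other half is left
  -- for the two error terms, which vanish as `ε → 0`.
  obtain ⟨η, hη1, hη⟩ : ∃ η : ℝ, (1 + η) ^ s < 1 + lam / 2 ∧ 0 < η := by
    have hc : Tendsto (fun η : ℝ => (1 + η) ^ s) (𝓝[>] 0) (𝓝 ((1 + 0) ^ s)) := by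
      refine Tendsto.mono_left (ContinuousAt.tendsto ?_) nhdsWithin_le_nhds
      exact (continuous_const.add continuous_id).continuousAt.rpow_const (by simp)
    rw [add_zero, Real.one_rpow] at hc
    exact ((hc.eventually (eventually_lt_nhds (by linarith))).and self_mem_nhdsWithin).exists
  have hmeas : ∀ ε : ℝ, MeasurableSet {z : E | η / ε < ‖z‖} := fun ε =>
    (isOpen_lt continuous_const continuous_norm).measurableSet
  have hl1 : Tendsto (fun ε : ℝ => ∫ z, {z : E | η / ε < ‖z‖}.indicator a z) (𝓝[>] 0)
      (𝓝 (∫ _ : E, (0 : ℝ))) := by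
    refine tendsto_integral_filter_of_dominated_convergence a
      (Eventually.of_forall fun ε => ?_) (Eventually.of_forall fun ε =>
        Eventually.of_forall fun z => ?_) ha.integrable (Eventually.of_forall fun z => ?_)
    · exact ha.continuous.aestronglyMeasurable.indicator (hmeas ε)
    · refine (norm_indicator_le_norm_self a z).trans ?_
      rw [Real.norm_of_nonneg (ha.nonneg z)]
    · refine tendsto_const_nhds.congr' ?_
      have h : Tendsto (fun ε : ℝ => η / ε) (𝓝[>] 0) atTop :=
        tendsto_inv_nhdsGT_zero.const_mul_atTop hη
      filter_upwards [h.eventually_ge_atTop ‖z‖] with ε hε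
      rw [Set.indicator_of_notMem]
      simpa using hε
  set J := ∫ x : E, (1 + ‖x‖) ^ (-s)
  -- Rescaling the integral of the weight costs `ε ^ (-d)` with `d` the dimension, against the gain
  -- `ε ^ s`; the power `s - d` is positive.
  have hl2 : Tendsto (fun ε : ℝ => cp * (2 + 1 / η) ^ s * J *
      ε ^ (s - Module.finrank ℝ E)) (𝓝[>] 0) (𝓝 (cp * (2 + 1 / η) ^ s * J * 0)) := by
    refine Tendsto.const_mul _ ?_
    have h : Tendsto (fun ε : ℝ => ε ^ (s - Module.finrank ℝ E)) (𝓝 0)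
        (𝓝 (0 ^ (s - (Module.finrank ℝ E : ℝ)))) :=
      (Real.continuousAt_rpow_const _ _ (Or.inr (by linarith))).tendsto
    rw [Real.zero_rpow (by linarith)] at h
    exact h.mono_left nhdsWithin_le_nhds
  rw [integral_zero] at hl1
  rw [mul_zero] at hl2
  have hl := (hl1.const_mul (2 ^ s)).add hl2
  rw [mul_zero, add_zero] at hl
  obtain ⟨ε, hε1, hε⟩ :=
    ((hl.eventually (eventually_lt_nhds (half_pos hlam))).and self_mem_nhdsWithin).exists
  replace hε : 0 < ε := hε
  refine ⟨ε, hε, fun x => ?_⟩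
  have hWi := (integrable_one_add_mul_norm_rpow (E := E) hs hε)
  have i1 := ha.integrable.const_mul ((1 + η) ^ s)
  have i2 := (ha.integrable.indicator (hmeas ε)).const_mul (2 ^ s)
  have i12 : Integrable fun z => (1 + η) ^ s * a z + 2 ^ s * {z : E | η / ε < ‖z‖}.indicator a z :=
    i1.add i2
  have i3 := (hWi.comp_sub_left x).const_mul (cp * (ε * (2 + 1 / η)) ^ s)
  have i4 : Integrable fun z => a z * (1 + ε * ‖x - z‖) ^ (-s) := by
    refine ha.integrable.mul_bdd (c := 1) ?_ (Eventually.of_forall fun z => ?_)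
    · exact (hWi.comp_sub_left x).aestronglyMeasurable
    · have h0 : 1 ≤ 1 + ε * ‖x - z‖ := by
        have : 0 ≤ ε * ‖x - z‖ := by positivity
        linarith
      rw [Real.norm_of_nonneg (by positivity)]
      exact Real.rpow_le_one_of_one_le_of_nonpos h0 (by linarith)
  calc ∫ y, a (x - y) * (1 + ε * ‖y‖) ^ (-s)
      = ∫ z, a z * (1 + ε * ‖x - z‖) ^ (-s) := by
        rw [← integral_sub_left_eq_self (fun z => a z * (1 + ε * ‖x - z‖) ^ (-s)) volume x]
        simp
    _ ≤ ∫ z, ((1 + η) ^ s * a z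
      + 2 ^ s * {z : E | η / ε < ‖z‖}.indicator a z
      + cp * (ε * (2 + 1 / η)) ^ s * (1 + ε * ‖x - z‖) ^ (-s)) * (1 + ε * ‖x‖) ^ (-s) :=
        integral_mono i4 ((i12.add i3).mul_const _) fun z =>
          mul_one_add_mul_norm_rpow_le ha hs0 hε hη hcp hle x z
    _ = ((1 + η) ^ s + (2 ^ s * (∫ z, {z : E | η / ε < ‖z‖}.indicator a z)
        + cp * (2 + 1 / η) ^ s * J * ε ^ (s - Module.finrank ℝ E))) *
        (1 + ε * ‖x‖) ^ (-s) := by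
        rw [integral_mul_const, integral_add i12 i3, integral_add i1 i2,
          integral_const_mul, integral_const_mul, integral_const_mul, ha.integral_eq_one,
          integral_sub_left_eq_self (fun z : E => (1 + ε * ‖z‖) ^ (-s)),
          integral_one_add_mul_norm_rpow hε, Real.mul_rpow hε.le (by positivity),
          sub_eq_add_neg s, Real.rpow_add hε]
        ring
    _ ≤ _ := mul_le_mul_of_nonneg_right (by linarith) (by positivity)

theorem IsStationarySolution.exists_polynomial_bounds {a V u : E → ℝ} {lam s cm cp : ℝ}
    (hlam : 0 < lam) (ha : IsDispersalKernel a) (hV : IsPotential V)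
    (hu : IsStationarySolution a V lam u) (hs : (Module.finrank ℝ E : ℝ) < s) (hcm : 0 < cm)
    (hge : ∀ x, cm * (1 + ‖x‖) ^ (-s) ≤ a x) (hle : ∀ x, a x ≤ cp * (1 + ‖x‖) ^ (-s)) :
    ∃ c₁ c₂ : ℝ, 0 < c₁ ∧ c₁ ≤ c₂ ∧
      ∀ x, c₁ * (1 + ‖x‖) ^ (-s) ≤ u x ∧ u x ≤ c₂ * (1 + ‖x‖) ^ (-s) := by
  have hs0 : 0 < s := (Nat.cast_nonneg _).trans_lt hs
  obtain ⟨ε, hε, hsup⟩ := ha.exists_polynomial_supersolution hlam hs hle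
  have hW1 : ∀ x : E, 1 ≤ 1 + ε * ‖x‖ := fun x => by
    have : 0 ≤ ε * ‖x‖ := by positivity
    linarith
  have hWc : Continuous fun x : E => (1 + ε * ‖x‖) ^ (-s) :=
    Continuous.rpow_const (by fun_prop) fun x => Or.inl (by linarith [hW1 x])
  have hWp : ∀ x : E, 0 < (1 + ε * ‖x‖) ^ (-s) := fun x =>
    Real.rpow_pos_of_pos (by linarith [hW1 x]) _
  obtain ⟨M, hM, huM⟩ := hu.le_mul_supersolution hlam ha hV hWc hWp
    (ha.integrable_mul_of_bounded hWc (B := 1) fun y => by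
      rw [abs_of_pos (hWp y)]
      exact Real.rpow_le_one_of_one_le_of_nonpos (hW1 y) (by linarith)) hsup
  obtain ⟨κ, R, hκ, hR, hlow⟩ := hu.exists_lower_bound hlam ha hV
  have hup : ∀ x, u x ≤ M * (1 + 1 / ε) ^ s * (1 + ‖x‖) ^ (-s) := fun x => by
    refine (huM x).trans ?_
    rw [mul_assoc]
    refine mul_le_mul_of_nonneg_left (rpow_neg_le_mul_rpow_neg (by linarith [hW1 x])
      (by positivity) (by positivity) hs0.le ?_) hM.le
    have : (1 + 1 / ε) * (1 + ε * ‖x‖) = 1 + ‖x‖ + 1 / ε + ε * ‖x‖ := by field_simp; ring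
    have : 0 ≤ 1 / ε + ε * ‖x‖ := by positivity
    linarith
  have hlo : ∀ x, κ * (cm * ((1 + R) ^ s)⁻¹) * (1 + ‖x‖) ^ (-s) ≤ u x := fun x => by
    rw [mul_assoc]
    refine hlow x _ fun z hz => le_trans ?_ (hge z)
    rw [mul_assoc]
    refine mul_le_mul_of_nonneg_left ?_ hcm.le
    rw [inv_mul_le_iff₀ (by positivity)]
    refine rpow_neg_le_mul_rpow_neg (by positivity) (by positivity) (by positivity) hs0.le ?_
    have h1 : ‖z‖ ≤ R + ‖x‖ := by
      have := norm_add_le (z - x) x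
      rw [sub_add_cancel] at this
      linarith
    nlinarith [norm_nonneg x]
  refine ⟨κ * (cm * ((1 + R) ^ s)⁻¹), M * (1 + 1 / ε) ^ s, by positivity, ?_,
    fun x => ⟨hlo x, hup x⟩⟩
  -- At the origin the weight is `1`, so the two bounds compare the constants.
  simpa using (hlo 0).trans (hup 0)

end Decay

theorem eventually_cocompact_real_iff {P : ℝ → Prop} :
    (∀ᶠ x in cocompact ℝ, P x) ↔ ∃ R, 0 < R ∧ ∀ x, R ≤ |x| → P x := by
  rw [← Metric.cobounded_eq_cocompact, ← comap_norm_atTop, eventually_comap]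
  constructor
  · intro h
    obtain ⟨R, hR⟩ := eventually_atTop.1 h
    exact ⟨max R 1, by positivity, fun x hx => hR _ ((le_max_left _ _).trans hx) x rfl⟩
  · rintro ⟨R, -, hR⟩
    filter_upwards [eventually_ge_atTop R] with b hb x hx
    exact hR x (by rw [← Real.norm_eq_abs, hx]; exact hb)

/-! ### Kernels on the line with an exponential rate: decay, positivity, uniqueness. -/

section Line

variable {a : ℝ → ℝ} {c : ℝ}

theorem exists_forall_pos_of_tendsto_log (ha : IsDispersalKernel a) (hc : 0 < c)
    (hlim : Tendsto (fun x : ℝ => Real.log (a x) / |x|) (cocompact ℝ) (𝓝 (-c))) :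
    ∃ R, 0 < R ∧ ∀ x, R ≤ |x| → 0 < a x := by
  rw [← eventually_cocompact_real_iff]
  filter_upwards [hlim.eventually (eventually_lt_nhds (neg_lt_zero.2 hc))] with x hx
  refine (ha.nonneg x).lt_of_ne fun h => ?_
  -- Because `Real.log 0 = 0`, a zero of `a` would make the quotient `0`, which is not negative.
  simp [← h] at hx

theorem exists_forall_exp_le_of_tendsto_log (ha : IsDispersalKernel a) (hc : 0 < c)
    (hlim : Tendsto (fun x : ℝ => Real.log (a x) / |x|) (cocompact ℝ) (𝓝 (-c)))
    {b : ℝ} (hb : c < b) : ∃ R, 0 < R ∧ ∀ x, R ≤ |x| → Real.exp (-(b * |x|)) ≤ a x := by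
  rw [← eventually_cocompact_real_iff]
  filter_upwards [hlim.eventually (eventually_gt_nhds (neg_lt_neg hb)),
    eventually_cocompact_real_iff.2 (exists_forall_pos_of_tendsto_log ha hc hlim),
    eventually_cocompact_real_iff.2 ⟨1, one_pos, fun x hx => hx⟩] with x h1 h2 h3
  rw [lt_div_iff₀ (by linarith)] at h1
  rw [← Real.le_log_iff_exp_le h2]
  linarith

theorem exists_le_exp_of_tendsto_log (ha : IsDispersalKernel a) (hc : 0 < c)
    (hlim : Tendsto (fun x : ℝ => Real.log (a x) / |x|) (cocompact ℝ) (𝓝 (-c)))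
    {b : ℝ} (hb : b < c) : ∃ C, ∀ x, a x ≤ C * Real.exp (-(b * ‖x‖)) := by
  obtain ⟨R, hR, hbd⟩ : ∃ R, 0 < R ∧ ∀ x, R ≤ |x| → a x ≤ Real.exp (-(b * |x|)) := by
    rw [← eventually_cocompact_real_iff]
    filter_upwards [hlim.eventually (eventually_lt_nhds (neg_lt_neg hb)),
      eventually_cocompact_real_iff.2 (exists_forall_pos_of_tendsto_log ha hc hlim),
      eventually_cocompact_real_iff.2 ⟨1, one_pos, fun x hx => hx⟩] with x h1 h2 h3
    rw [div_lt_iff₀ (by linarith)] at h1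
    rw [← Real.log_le_iff_le_exp h2]
    linarith
  obtain ⟨M, hM⟩ := (isCompact_closedBall (0 : ℝ) R).bddAbove_image
    (f := fun x => a x / Real.exp (-(b * ‖x‖)))
    (ha.continuous.div (by fun_prop) fun x => (Real.exp_pos _).ne').continuousOn
  refine ⟨max M 1, fun x => ?_⟩
  rcases le_total R |x| with h | h
  · calc a x ≤ 1 * Real.exp (-(b * |x|)) := by rw [one_mul]; exact hbd x h
      _ ≤ _ := mul_le_mul_of_nonneg_right (le_max_right _ _) (Real.exp_pos _).le
  · have := (div_le_iff₀ (Real.exp_pos _)).1 (hM ⟨x, by simpa using h, rfl⟩)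
    exact this.trans (mul_le_mul_of_nonneg_right (le_max_left _ _) (Real.exp_pos _).le)

theorem integrable_mul_exp_abs_of_tendsto_log (ha : IsDispersalKernel a) (hc : 0 < c)
    (hlim : Tendsto (fun x : ℝ => Real.log (a x) / |x|) (cocompact ℝ) (𝓝 (-c)))
    {q : ℝ} (hq : q < c) : Integrable fun x => a x * Real.exp (q * |x|) := by
  obtain ⟨C, hC⟩ := exists_le_exp_of_tendsto_log ha hc hlim (b := (q + c) / 2) (by linarith)
  exact ha.integrable_mul_exp_norm (by linarith) hC

theorem integrable_mul_exp_of_tendsto_log (ha : IsDispersalKernel a) (hc : 0 < c)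
    (hlim : Tendsto (fun x : ℝ => Real.log (a x) / |x|) (cocompact ℝ) (𝓝 (-c)))
    {q : ℝ} (hq : |q| < c) : Integrable fun x => a x * Real.exp (q * x) := by
  refine (integrable_mul_exp_abs_of_tendsto_log ha hc hlim hq).mono'
    (ha.continuous.mul (by fun_prop)).aestronglyMeasurable (Eventually.of_forall fun x => ?_)
  rw [Real.norm_of_nonneg (mul_nonneg (ha.nonneg x) (Real.exp_pos _).le)]
  refine mul_le_mul_of_nonneg_left (Real.exp_le_exp.2 ?_) (ha.nonneg x)
  rw [← abs_mul]
  exact le_abs_self _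

theorem integral_mul_exp_neg (ha : IsDispersalKernel a) (q : ℝ) :
    ∫ x, a x * Real.exp (-q * x) = ∫ x, a x * Real.exp (q * x) := by
  rw [← integral_neg_eq_self (fun x => a x * Real.exp (q * x))]
  simp [ha.even]

theorem kernelTransform_I_mul (a : ℝ → ℝ) (q : ℝ) :
    kernelTransform a (Complex.I * (q : ℂ)) = ((∫ x, a x * Real.exp (q * x) : ℝ) : ℂ) := by
  rw [kernelTransform, ← integral_complex_ofReal]
  congr 1
  ext x
  have : -(Complex.I * (Complex.I * (q : ℂ)) * (x : ℂ)) = ((q * x : ℝ) : ℂ) := by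
    rw [← mul_assoc, Complex.I_mul_I]; push_cast; ring
  rw [this, ← Complex.ofReal_exp]
  push_cast
  ring

theorem kernelTransform_I_mul_eq_iff (a : ℝ → ℝ) (q lam : ℝ) :
    kernelTransform a (Complex.I * (q : ℂ)) = 1 + (lam : ℂ) ↔
      ∫ x, a x * Real.exp (q * x) = 1 + lam := by
  rw [kernelTransform_I_mul]
  exact_mod_cast Iff.rfl

/-- The moment is continuous in the rate and equals `1` at rate `0`; by the intermediate value
theorem it cannot reach `1 + lam` without taking that value. -/
theorem integral_mul_exp_lt_of_forall_ne (ha : IsDispersalKernel a) (hc : 0 < c)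
    (hlim : Tendsto (fun x : ℝ => Real.log (a x) / |x|) (cocompact ℝ) (𝓝 (-c)))
    {lam : ℝ} (hlam : 0 < lam)
    (hne : ∀ q, 0 < q → q < c → ∫ x, a x * Real.exp (q * x) ≠ 1 + lam)
    {q : ℝ} (hq0 : 0 < q) (hqc : q < c) : ∫ x, a x * Real.exp (q * x) < 1 + lam := by
  by_contra! h
  have hcont : ContinuousOn (fun t => ∫ x, a x * Real.exp (t * x)) (Set.Icc 0 q) := by
    refine continuousOn_of_dominated (bound := fun x => a x * Real.exp (q * |x|))
      (fun t _ => (ha.continuous.mul (by fun_prop)).aestronglyMeasurable)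
      (fun t ht => Eventually.of_forall fun x => ?_)
      (integrable_mul_exp_abs_of_tendsto_log ha hc hlim hqc)
      (Eventually.of_forall fun x => by fun_prop)
    rw [Real.norm_of_nonneg (mul_nonneg (ha.nonneg x) (Real.exp_pos _).le)]
    refine mul_le_mul_of_nonneg_left (Real.exp_le_exp.2 ?_) (ha.nonneg x)
    calc t * x ≤ t * |x| := mul_le_mul_of_nonneg_left (le_abs_self x) ht.1
      _ ≤ q * |x| := mul_le_mul_of_nonneg_right ht.2 (abs_nonneg x)
  have h0 : ∫ x, a x * Real.exp (0 * x) = 1 := by simpa using ha.integral_eq_one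
  obtain ⟨t, ht, hte⟩ := intermediate_value_Icc hq0.le hcont
    (show 1 + lam ∈ Set.Icc _ _ from ⟨by simp only [h0]; linarith, h⟩)
  have ht0 : t ≠ 0 := by
    rintro rfl
    simp only [h0] at hte
    linarith
  exact hne t (ht.1.lt_of_ne ht0.symm) (ht.2.trans_lt hqc) hte

variable {V u : ℝ → ℝ} {lam : ℝ}

/-- The one-sided exponential is an exact eigenfunction of the convolution, so nothing is lost and
the critical rate, with moment equal to `1 + lam`, is allowed. -/
theorem IsStationarySolution.exists_le_exp_mul (hlam : 0 < lam) (ha : IsDispersalKernel a)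
    (hV : IsPotential V) (hu : IsStationarySolution a V lam u) {q : ℝ}
    (hint : Integrable fun x => a x * Real.exp (q * x))
    (hle : ∫ x, a x * Real.exp (q * x) ≤ 1 + lam) :
    ∃ M, 0 < M ∧ ∀ x, u x ≤ M * Real.exp (-(q * x)) := by
  have hexp : ∀ x y, a (x - y) * Real.exp (-(q * y)) =
      a (x - y) * Real.exp (q * (x - y)) * Real.exp (-(q * x)) := fun x y => by
    rw [mul_assoc, ← Real.exp_add]; congr 2; ring
  refine hu.le_mul_supersolution hlam ha hV (by fun_prop) (fun x => Real.exp_pos _) (fun x => ?_)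
    fun x => ?_
  · simp only [hexp]
    exact (hint.comp_sub_left x).mul_const _
  · simp only [hexp]
    rw [integral_mul_const, integral_sub_left_eq_self (fun y => a y * Real.exp (q * y))]
    exact mul_le_mul_of_nonneg_right hle (Real.exp_pos _).le

theorem IsStationarySolution.exists_le_exp_abs (hlam : 0 < lam) (ha : IsDispersalKernel a)
    (hV : IsPotential V) (hu : IsStationarySolution a V lam u) (hc : 0 < c)
    (hlim : Tendsto (fun x : ℝ => Real.log (a x) / |x|) (cocompact ℝ) (𝓝 (-c)))
    {q : ℝ} (hq0 : 0 < q) (hqc : q < c) (hle : ∫ x, a x * Real.exp (q * x) ≤ 1 + lam) :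
    ∃ M, 0 < M ∧ ∀ x, u x ≤ M * Real.exp (-(q * |x|)) := by
  have hq : |q| < c := by rwa [abs_of_pos hq0]
  obtain ⟨M₁, hM₁, h₁⟩ := hu.exists_le_exp_mul hlam ha hV
    (integrable_mul_exp_of_tendsto_log ha hc hlim hq) hle
  obtain ⟨M₂, hM₂, h₂⟩ := hu.exists_le_exp_mul (q := -q) hlam ha hV
    (integrable_mul_exp_of_tendsto_log ha hc hlim (by rwa [abs_neg]))
    (by rwa [integral_mul_exp_neg ha])
  refine ⟨max M₁ M₂, by positivity, fun x => ?_⟩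
  rcases le_total 0 x with hx | hx
  · rw [abs_of_nonneg hx]
    exact (h₁ x).trans (mul_le_mul_of_nonneg_right (le_max_left _ _) (Real.exp_pos _).le)
  · rw [abs_of_nonpos hx]
    have := h₂ x
    rw [neg_mul, ← mul_neg] at this
    exact this.trans (mul_le_mul_of_nonneg_right (le_max_right _ _) (Real.exp_pos _).le)

/-- Strong maximum principle: a nonnegative solution that vanishes somewhere is zero. -/
theorem eq_zero_of_nonneg_of_exists_eq_zero (ha : IsDispersalKernel a)
    (hpos : ∃ R, 0 < R ∧ ∀ x, R ≤ |x| → 0 < a x) {w : ℝ → ℝ} (hw : Continuous w)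
    (hw0 : ∀ x, 0 ≤ w x) (hint : ∀ x, Integrable fun y => a (x - y) * w y)
    (heq : ∀ x, (1 + lam) * w x = (∫ y, a (x - y) * w y) + V x * w x)
    {x₀ : ℝ} (hx₀ : w x₀ = 0) (x : ℝ) : w x = 0 := by
  obtain ⟨R, hR, hpos⟩ := hpos
  -- At a zero of `w` the integral of the nonnegative `a (x - y) * w y` vanishes, so `w` vanishes
  -- wherever `a (x - y) > 0`. Any point is reached from `x₀` by two jumps of length at least `R`.
  have step : ∀ x, w x = 0 → ∀ y, R ≤ |x - y| → w y = 0 := by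
    intro x hx y hy
    have h1 : ∫ y, a (x - y) * w y = 0 := by simpa [hx] using (heq x).symm
    rw [integral_eq_zero_iff_of_nonneg (fun y => mul_nonneg (ha.nonneg _) (hw0 y)) (hint x)] at h1
    have hcont : Continuous fun y => a (x - y) * w y :=
      (ha.continuous.comp (continuous_const.sub continuous_id)).mul hw
    have h2 := congrFun ((hcont.ae_eq_iff_eq volume continuous_zero).1 h1) y
    exact (mul_eq_zero.1 h2).resolve_left (hpos _ hy).ne'
  have h1 := step x₀ hx₀ (|x| + |x₀| + R) (by
    rw [abs_sub_comm]
    refine le_trans ?_ (le_abs_self _)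
    linarith [le_abs_self x₀, abs_nonneg x])
  refine step _ h1 x (le_trans ?_ (le_abs_self _))
  linarith [le_abs_self x, abs_nonneg x₀]

theorem IsStationarySolution.pos (ha : IsDispersalKernel a)
    (hpos : ∃ R, 0 < R ∧ ∀ x, R ≤ |x| → 0 < a x) (hu : IsStationarySolution a V lam u) (x : ℝ) :
    0 < u x := by
  refine (hu.nonneg x).lt_of_ne fun h => ?_
  obtain ⟨y, hy⟩ := hu.exists_pos
  exact hy.ne' (eq_zero_of_nonneg_of_exists_eq_zero ha hpos hu.continuous hu.nonneg
    (hu.integrable_mul ha) hu.eq h.symm y)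

/-- Far from the origin the lower bound of the kernel on a ball of radius `R` is passed on to `u`;
on the remaining compact set the positive minimum of `u` suffices. -/
theorem IsStationarySolution.exists_exp_le (hlam : 0 < lam) (ha : IsDispersalKernel a)
    (hV : IsPotential V) (hu : IsStationarySolution a V lam u) (hc : 0 < c)
    (hlim : Tendsto (fun x : ℝ => Real.log (a x) / |x|) (cocompact ℝ) (𝓝 (-c)))
    {b : ℝ} (hb : c < b) : ∃ C, 0 < C ∧ ∀ x, C * Real.exp (-(b * |x|)) ≤ u x := by
  obtain ⟨R₀, hR₀, hexp⟩ := exists_forall_exp_le_of_tendsto_log ha hc hlim hb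
  obtain ⟨κ, R, hκ, hR, hlow⟩ := hu.exists_lower_bound hlam ha hV
  obtain ⟨z, -, hz⟩ := (isCompact_closedBall (0 : ℝ) (R₀ + R)).exists_isMinOn
    ⟨0, by simp; positivity⟩ hu.continuous.continuousOn
  have hz0 := hu.pos ha (exists_forall_pos_of_tendsto_log ha hc hlim) z
  refine ⟨min (u z) (κ * Real.exp (-(b * R))), by positivity, fun x => ?_⟩
  rcases le_total |x| (R₀ + R) with hx | hx
  · calc _ ≤ u z * 1 := by
          refine mul_le_mul (min_le_left _ _) ?_ (Real.exp_pos _).le hz0.le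
          rw [Real.exp_le_one_iff]
          have : 0 ≤ b * |x| := mul_nonneg (by linarith) (abs_nonneg x)
          linarith
      _ ≤ u x := by rw [mul_one]; exact hz (by simpa using hx)
  · calc _ ≤ κ * Real.exp (-(b * R)) * Real.exp (-(b * |x|)) :=
          mul_le_mul_of_nonneg_right (min_le_right _ _) (Real.exp_pos _).le
      _ = κ * Real.exp (-(b * (R + |x|))) := by rw [mul_assoc, ← Real.exp_add]; congr 2; ring
      _ ≤ u x := hlow x _ fun y hy => by
        rw [Real.norm_eq_abs] at hy
        have h1 : |y| ≤ R + |x| := by have := abs_sub_abs_le_abs_sub y x; linarith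
        have h2 : R₀ ≤ |y| := by
          have := abs_sub_abs_le_abs_sub x y
          rw [abs_sub_comm] at this
          linarith
        refine le_trans (Real.exp_le_exp.2 ?_) (hexp y h2)
        have := mul_le_mul_of_nonneg_left h1 (hc.trans hb).le
        linarith

/-- Stationary solutions are unique up to a constant factor. -/
theorem IsStationarySolution.exists_eq_mul (hlam : 0 < lam) (ha : IsDispersalKernel a)
    (hpos : ∃ R, 0 < R ∧ ∀ x, R ≤ |x| → 0 < a x) (hV : IsPotential V)
    (hu : IsStationarySolution a V lam u) {v : ℝ → ℝ} (hv : IsStationarySolution a V lam v) :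
    ∃ t, ∀ x, u x = t * v x := by
  have hvp := hv.pos ha hpos
  have hne : (tsupport V).Nonempty := by
    by_contra! h
    exact hV.ne_zero (tsupport_eq_empty_iff.1 h)
  obtain ⟨z, hzK, hz⟩ := hV.hasCompactSupport.isCompact.exists_isMinOn hne
    (hu.continuous.div hv.continuous fun x => (hvp x).ne').continuousOn
  -- With `t` the minimum of `u / v` on the support of `V`, the difference `u - t v` is nonnegative
  -- there, hence everywhere by the maximum principle. It vanishes at `z`, so the strong maximum
  -- principle makes it zero.
  set t := u z / v z
  have ht : 0 ≤ t := div_nonneg (hu.nonneg z) (hv.nonneg z)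
  have hint : ∀ x, Integrable fun y => a (x - y) * (u y - t * v y) := fun x => by
    have := (hu.integrable_mul ha x).sub ((hv.integrable_mul ha x).const_mul t)
    refine this.congr (Eventually.of_forall fun y => ?_)
    simp only [Pi.sub_apply]
    ring
  have heq : ∀ x, (1 + lam) * (u x - t * v x) =
      (∫ y, a (x - y) * (u y - t * v y)) + V x * (u x - t * v x) := fun x => by
    have h1 : ∫ y, a (x - y) * (u y - t * v y) =
        (∫ y, a (x - y) * u y) - t * ∫ y, a (x - y) * v y := by
      rw [← integral_const_mul, ← integral_sub (hu.integrable_mul ha x)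
        ((hv.integrable_mul ha x).const_mul t)]
      congr 1
      ext y
      ring
    rw [h1]
    linear_combination hu.eq x - t * hv.eq x
  have hw : ∀ x, 0 ≤ u x - t * v x := fun x => by
    obtain ⟨B, hB⟩ := hv.bounded
    have := nonpos_of_subsolution (w := fun x => -(u x - t * v x)) (K := tsupport V) hlam ha
      ⟨t * B, fun x => by
        have := mul_le_mul_of_nonneg_left (hB x) ht
        linarith [hu.nonneg x]⟩
      (fun x hx => by
        have : t * v x ≤ u x := (le_div_iff₀ (hvp x)).1 (hz hx)
        linarith)
      (fun x _ => by simp only [mul_neg]; exact (hint x).neg)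
      (fun x hx => by
        simp only [mul_neg]
        rw [integral_neg]
        have h1 := heq x
        rw [image_eq_zero_of_notMem_tsupport hx, zero_mul, add_zero] at h1
        rw [h1]) x
    linarith
  refine ⟨t, fun x => ?_⟩
  have := eq_zero_of_nonneg_of_exists_eq_zero (w := fun x => u x - t * v x) ha hpos
    (hu.continuous.sub (hv.continuous.const_mul t)) hw hint heq
    (x₀ := z) (by simp only [t]; rw [div_mul_cancel₀ _ (hvp z).ne', sub_self]) x
  linarith

theorem IsPotential.comp_neg (hV : IsPotential V) : IsPotential fun x => V (-x) where
  continuous := hV.continuous.comp continuous_neg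
  hasCompactSupport := hV.hasCompactSupport.comp_homeomorph (Homeomorph.neg ℝ)
  nonneg x := hV.nonneg _
  le_one x := hV.le_one _
  ne_zero h := hV.ne_zero (funext fun x => by simpa using congrFun h (-x))

theorem IsStationarySolution.comp_neg (ha : IsDispersalKernel a)
    (hu : IsStationarySolution a V lam u) :
    IsStationarySolution a (fun x => V (-x)) lam fun x => u (-x) where
  continuous := hu.continuous.comp continuous_neg
  nonneg x := hu.nonneg _
  bounded := hu.bounded.imp fun B hB x => hB _
  exists_pos := by
    obtain ⟨x, hx⟩ := hu.exists_pos
    exact ⟨-x, by simpa using hx⟩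
  eq x := by
    rw [hu.eq (-x), ← integral_neg_eq_self (fun y => a (-x - y) * u y)]
    congr 2
    ext y
    rw [← ha.even]
    congr 2
    ring

/-- The reflected function solves the same equation, hence is a multiple of `u`; comparing at `0`
shows that the factor is `1`. -/
theorem IsStationarySolution.comp_neg_eq (hlam : 0 < lam) (ha : IsDispersalKernel a)
    (hpos : ∃ R, 0 < R ∧ ∀ x, R ≤ |x| → 0 < a x) (hV : IsPotential V)
    (hu : IsStationarySolution a V lam u) (hVe : ∀ x, V (-x) = V x) (x : ℝ) : u (-x) = u x := by
  have hu' := hu.comp_neg ha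
  simp only [hVe] at hu'
  obtain ⟨t, ht⟩ := hu'.exists_eq_mul hlam ha hpos hV hu
  have h0 := ht 0
  have hu0 := hu.pos ha hpos 0
  rw [neg_zero] at h0
  have : t = 1 := by
    have : (t - 1) * u 0 = 0 := by linarith
    rcases mul_eq_zero.1 this with h | h
    · linarith
    · exact absurd h hu0.ne'
  rw [ht x, this, one_mul]

end Line

/-! ### Renewal equation on the line with a two-sided kernel. -/

section Renewal

/-- The convolution of an integrable function with a bounded continuous function is uniformly
continuous. -/
theorem uniformContinuous_integral_mul_comp_sub {p h : ℝ → ℝ} (hp : Integrable p)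
    (hh : Continuous h) {B : ℝ} (hB : ∀ x, |h x| ≤ B) :
    UniformContinuous fun x => ∫ y, p y * h (x - y) := by
  have hm : MemLp (fun x => p (-x)) 1 volume := memLp_one_iff_integrable.2 hp.comp_neg
  set P : Lp ℝ 1 (volume : Measure ℝ) := hm.toLp
  have : Fact ((1 : ENNReal) ≠ ⊤) := ⟨by norm_num⟩
  have hB0 : 0 ≤ B := (abs_nonneg _).trans (hB 0)
  have hP : ∀ t : ℝ, DomAddAct.mk t +ᵥ P =ᵐ[volume] fun y => p (-(t + y)) := by
    intro t
    have h2 : (fun y => P (t + y)) =ᵐ[volume] fun y => p (-(t + y)) :=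
      (measurePreserving_add_left volume t).quasiMeasurePreserving.ae_eq_comp hm.coeFn_toLp
    filter_upwards [DomAddAct.vadd_Lp_ae_eq (DomAddAct.mk t) P, h2] with y e1 e2
    rw [e1]
    exact e2
  have hint : ∀ x, Integrable fun y => p (x - y) * h y := fun x =>
    (hp.comp_sub_left x).mul_bdd (c := B) hh.aestronglyMeasurable (Eventually.of_forall hB)
  have hconv : ∀ x, ∫ y, p y * h (x - y) = ∫ y, p (x - y) * h y := fun x => by
    rw [← integral_sub_left_eq_self (fun y => p y * h (x - y)) volume x]
    simp
  -- Increments are controlled by the `L¹` distance between translates of the reflected kernel,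
  -- which depends only on `x' - x` and tends to `0` with it.
  have key : ∀ x x', dist (∫ y, p y * h (x - y)) (∫ y, p y * h (x' - y)) ≤
      B * dist (DomAddAct.mk (x' - x) +ᵥ P) P := by
    intro x x'
    have e : dist (DomAddAct.mk (x' - x) +ᵥ P) P = dist (DomAddAct.mk (-x) +ᵥ P)
        (DomAddAct.mk (-x') +ᵥ P) := by
      rw [← DomAddAct.dist_vadd_Lp (DomAddAct.mk (-x')) (DomAddAct.mk (x' - x) +ᵥ P) P, vadd_vadd,
        ← DomAddAct.mk_add]
      congr 3
      ring
    rw [e, hconv, hconv, Real.dist_eq, ← integral_sub (hint x) (hint x'), L1.dist_eq_integral_dist,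
      ← integral_const_mul]
    have hc : (fun y => B * dist ((DomAddAct.mk (-x) +ᵥ P : Lp ℝ 1 (volume : Measure ℝ)) y)
        ((DomAddAct.mk (-x') +ᵥ P : Lp ℝ 1 (volume : Measure ℝ)) y)) =ᵐ[volume]
        fun y => B * |p (x - y) - p (x' - y)| := by
      filter_upwards [hP (-x), hP (-x')] with y e1 e2
      rw [e1, e2, Real.dist_eq]
      congr 4 <;> ring_nf
    rw [integral_congr_ae hc]
    refine (abs_integral_le_integral_abs).trans (integral_mono ((hint x).sub (hint x')).abs
      (((hp.comp_sub_left x).sub (hp.comp_sub_left x')).abs.const_mul B) fun y => ?_)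
    simp only []
    rw [← sub_mul, abs_mul, mul_comm]
    exact mul_le_mul_of_nonneg_right (hB y) (abs_nonneg _)
  have hlim : Tendsto (fun t : ℝ => B * dist (DomAddAct.mk t +ᵥ P) P) (𝓝 0) (𝓝 0) := by
    have hc : Continuous fun t : ℝ => B * dist (DomAddAct.mk t +ᵥ P) P :=
      continuous_const.mul
        ((DomAddAct.continuous_mk.vadd continuous_const).dist continuous_const)
    have := hc.tendsto 0
    rwa [DomAddAct.mk_zero, zero_vadd, dist_self, mul_zero] at this
  rw [Metric.uniformContinuous_iff]
  intro ε hε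
  obtain ⟨δ, hδ, hd⟩ := Metric.eventually_nhds_iff.1 (hlim.eventually (eventually_lt_nhds hε))
  refine ⟨δ, hδ, fun {x x'} hx => (key x x').trans_lt (hd ?_)⟩
  rwa [dist_zero_right, ← dist_eq_norm, dist_comm]

variable {p h : ℝ → ℝ} {B M : ℝ}

/-- Along points where a solution of the renewal equation approaches its upper limit, its
translates by points charged by the kernel approach it as well. -/
theorem tendsto_comp_sub_of_renewal_eq {ι : Type*} {l : Filter ι} [l.IsCountablyGenerated]
    (hpc : Continuous p) (hp0 : ∀ y, 0 ≤ p y) (hpi : Integrable p) (hp1 : ∫ y, p y = 1)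
    (hh : UniformContinuous h) (hB : ∀ x, |h x| ≤ B)
    (heq : ∀ᶠ x in atTop, h x = ∫ y, p y * h (x - y))
    (hup : ∀ ε, 0 < ε → ∀ᶠ x in atTop, h x < M + ε) {x : ι → ℝ} (hx : Tendsto x l atTop)
    (hM : Tendsto (fun i => h (x i)) l (𝓝 M)) {y₀ : ℝ} (hy₀ : 0 < p y₀) :
    Tendsto (fun i => h (x i - y₀)) l (𝓝 M) := by
  have hhc := hh.continuous
  have hint : ∀ s, Integrable fun y => p y * h (s - y) := fun s =>
    hpi.mul_bdd (c := B) (by fun_prop) (Eventually.of_forall fun y => hB _)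
  have hintM : ∀ s, Integrable fun y => p y * (M - h (s - y)) := fun s => by
    simp only [mul_sub]; exact (hpi.mul_const M).sub (hint s)
  have hbd : ∀ s, |M - h s| ≤ |M| + B := fun s => (abs_sub _ _).trans (by linarith [hB s])
  -- The renewal equation makes the weighted mean of `M - h(x i - y)` tend to `0`. Its negative part
  -- vanishes in the limit by `hup`, so the mean of the absolute value does too, by `|s| = s + 2
  -- s⁻`.
  have T1 : Tendsto (fun i => ∫ y, p y * (M - h (x i - y))) l (𝓝 0) := by
    have h1 : Tendsto (fun i => M - h (x i)) l (𝓝 0) := by simpa using hM.const_sub M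
    refine h1.congr' ?_
    filter_upwards [hx.eventually heq] with i hi
    simp only [mul_sub]
    rw [integral_sub (hpi.mul_const M) (hint _), integral_mul_const, hp1, one_mul, ← hi]
  have hintneg : ∀ s, Integrable fun y => p y * max (-(M - h (s - y))) 0 := fun s => by
    refine hpi.mul_bdd (c := |M| + B) (by fun_prop) (Eventually.of_forall fun y => ?_)
    rw [Real.norm_of_nonneg (le_max_right _ _)]
    exact max_le ((neg_le_abs _).trans (hbd _)) ((abs_nonneg _).trans (hbd 0))
  have T2 : Tendsto (fun i => ∫ y, p y * max (-(M - h (x i - y))) 0) l (𝓝 (∫ _ : ℝ, (0 : ℝ))) := by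
    refine tendsto_integral_filter_of_dominated_convergence (fun y => p y * (|M| + B))
      (Eventually.of_forall fun i => (hintneg _).aestronglyMeasurable)
      (Eventually.of_forall fun i => Eventually.of_forall fun y => ?_) (hpi.mul_const _)
      (Eventually.of_forall fun y => ?_)
    · rw [Real.norm_of_nonneg (mul_nonneg (hp0 y) (le_max_right _ _))]
      exact mul_le_mul_of_nonneg_left
        (max_le ((neg_le_abs _).trans (hbd _)) ((abs_nonneg _).trans (hbd 0))) (hp0 y)
    · have : Tendsto (fun i => max (-(M - h (x i - y))) 0) l (𝓝 0) := by
        rw [Metric.tendsto_nhds]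
        intro ε hε
        have hx' : Tendsto (fun i => x i - y) l atTop := tendsto_atTop_add_const_right _ _ hx
        filter_upwards [hx'.eventually (hup ε hε)] with i hi
        rw [Real.dist_eq, sub_zero, abs_of_nonneg (le_max_right _ _)]
        exact max_lt (by linarith) hε
      simpa using this.const_mul (p y)
  have T3 : Tendsto (fun i => ∫ y, p y * |M - h (x i - y)|) l (𝓝 0) := by
    have := T1.add (T2.const_mul 2)
    rw [integral_zero, mul_zero, add_zero] at this
    refine this.congr fun i => ?_
    rw [← integral_const_mul, ← integral_add (hintM _) ((hintneg _).const_mul 2)]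
    congr 1
    ext y
    rcases le_total 0 (M - h (x i - y)) with h | h
    · rw [abs_of_nonneg h, max_eq_right (by linarith)]; ring
    · rw [abs_of_nonpos h, max_eq_left (by linarith)]; ring
  have hintabs : ∀ s, Integrable fun y => p y * |M - h (s - y)| := fun s => by
    refine (hintM s).norm.congr (Eventually.of_forall fun y => ?_)
    simp only []
    rw [norm_mul, Real.norm_of_nonneg (hp0 y), Real.norm_eq_abs]
  rw [Metric.tendsto_nhds]
  intro ε hε
  -- From the mean to a point: a deviation of `ε` at `x i - y₀` would persist as `ε / 2` on a ball
  -- where `p > p y₀ / 2`, and keep the mean away from `0`.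
  obtain ⟨δ₁, hδ₁, hd₁⟩ := Metric.uniformContinuous_iff.1 hh (ε / 2) (half_pos hε)
  obtain ⟨δ₂, hδ₂, hd₂⟩ := Metric.eventually_nhds_iff.1
    (hpc.continuousAt.eventually (eventually_gt_nhds (half_lt_self hy₀)))
  set δ := min δ₁ δ₂
  have hδ : 0 < δ := lt_min hδ₁ hδ₂
  have hvol : volume.real (Metric.ball y₀ δ) = 2 * δ := by
    rw [Measure.real, Real.volume_ball, ENNReal.toReal_ofReal (by positivity)]
  filter_upwards [T3.eventually (eventually_lt_nhds
    (show 0 < 2 * δ * (p y₀ / 2 * (ε / 2)) by positivity))] with i hi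
  by_contra! hcon
  rw [Real.dist_eq, abs_sub_comm] at hcon
  refine hi.not_ge ?_
  calc 2 * δ * (p y₀ / 2 * (ε / 2)) = ∫ y in Metric.ball y₀ δ, p y₀ / 2 * (ε / 2) := by
        rw [setIntegral_const, smul_eq_mul, hvol]
    _ ≤ ∫ y in Metric.ball y₀ δ, p y * |M - h (x i - y)| := by
        refine setIntegral_mono_on (integrableOn_const measure_ball_lt_top.ne)
          (hintabs _).integrableOn measurableSet_ball fun y hy => ?_
        rw [Metric.mem_ball] at hy
        have h1 : p y₀ / 2 < p y := hd₂ (hy.trans_le (min_le_right _ _))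
        have h2 := hd₁ (a := x i - y) (b := x i - y₀) (by
          rw [dist_sub_left]; exact hy.trans_le (min_le_left _ _))
        rw [Real.dist_eq] at h2
        have h3 : |M - h (x i - y₀)| ≤ |M - h (x i - y)| + |h (x i - y) - h (x i - y₀)| :=
          abs_sub_le _ _ _
        exact mul_le_mul h1.le (by linarith) (by positivity) (hp0 y)
    _ ≤ ∫ y, p y * |M - h (x i - y)| :=
        setIntegral_le_integral (hintabs _) (Eventually.of_forall fun y =>
          mul_nonneg (hp0 y) (abs_nonneg _))

/-- Every shift `t` is the sum of `R + |t|` and `t - (R + |t|)`, both of modulus at least `R`, where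
the kernel is positive. -/
theorem tendsto_comp_sub_of_renewal_eq' {ι : Type*} {l : Filter ι} [l.IsCountablyGenerated]
    (hpc : Continuous p) (hp0 : ∀ y, 0 ≤ p y) (hpi : Integrable p) (hp1 : ∫ y, p y = 1)
    (hpos : ∃ R, 0 < R ∧ ∀ x, R ≤ |x| → 0 < p x)
    (hh : UniformContinuous h) (hB : ∀ x, |h x| ≤ B)
    (heq : ∀ᶠ x in atTop, h x = ∫ y, p y * h (x - y))
    (hup : ∀ ε, 0 < ε → ∀ᶠ x in atTop, h x < M + ε) {x : ι → ℝ} (hx : Tendsto x l atTop)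
    (hM : Tendsto (fun i => h (x i)) l (𝓝 M)) (t : ℝ) :
    Tendsto (fun i => h (x i - t)) l (𝓝 M) := by
  obtain ⟨R, hR, hpos⟩ := hpos
  have h1 := tendsto_comp_sub_of_renewal_eq hpc hp0 hpi hp1 hh hB heq hup hx hM
    (y₀ := R + |t|) (hpos _ (le_trans (by linarith [abs_nonneg t]) (le_abs_self _)))
  have h2 := tendsto_comp_sub_of_renewal_eq hpc hp0 hpi hp1 hh hB heq hup
    (tendsto_atTop_add_const_right _ (-(R + |t|)) hx) h1
    (y₀ := t - (R + |t|)) (hpos _ (by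
      rw [abs_sub_comm]
      exact le_trans (by linarith [le_abs_self t]) (le_abs_self _)))
  refine h2.congr fun i => ?_
  congr 1
  ring

/-- The conserved quantity of the renewal equation. -/
noncomputable def renewalFlux (p h : ℝ → ℝ) (x : ℝ) : ℝ :=
  ∫ y, p y * ∫ t in (0 : ℝ)..y, h (x - t)

theorem abs_intervalIntegral_comp_sub_le (hB : ∀ x, |h x| ≤ B) (x y : ℝ) :
    |∫ t in (0 : ℝ)..y, h (x - t)| ≤ B * |y| := by
  have := intervalIntegral.norm_integral_le_of_norm_le_const (a := 0) (b := y)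
    (f := fun t => h (x - t)) (C := B) fun t _ => hB _
  simpa using this

theorem continuous_intervalIntegral_comp_sub (hh : Continuous h) (x : ℝ) :
    Continuous fun y : ℝ => ∫ t in (0 : ℝ)..y, h (x - t) :=
  intervalIntegral.continuous_primitive
    (fun a b => Continuous.intervalIntegrable (by fun_prop) a b) 0

theorem tendsto_renewalFlux {ι : Type*} {l : Filter ι} [l.IsCountablyGenerated]
    (hpi : Integrable p) (hpm : Integrable fun y => p y * y)
    (hh : Continuous h) (hB : ∀ x, |h x| ≤ B) {x : ι → ℝ}
    (hM : ∀ t, Tendsto (fun i => h (x i - t)) l (𝓝 M)) :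
    Tendsto (fun i => renewalFlux p h (x i)) l (𝓝 (M * ∫ y, p y * y)) := by
  have e : M * ∫ y, p y * y = ∫ y, p y * ∫ t in (0 : ℝ)..y, M := by
    rw [← integral_const_mul]
    congr 1
    ext y
    rw [intervalIntegral.integral_const, smul_eq_mul]
    ring
  rw [e]
  refine tendsto_integral_filter_of_dominated_convergence (fun y => B * |p y * y|)
    (Eventually.of_forall fun i => hpi.aestronglyMeasurable.mul
      (continuous_intervalIntegral_comp_sub hh _).aestronglyMeasurable)
    (Eventually.of_forall fun i => Eventually.of_forall fun y => ?_) (hpm.abs.const_mul B)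
    (Eventually.of_forall fun y => Tendsto.const_mul _ ?_)
  · rw [norm_mul, Real.norm_eq_abs, Real.norm_eq_abs, abs_mul, mul_left_comm]
    exact mul_le_mul_of_nonneg_left (abs_intervalIntegral_comp_sub_le hB _ _) (abs_nonneg _)
  · refine intervalIntegral.tendsto_integral_filter_of_dominated_convergence (fun _ => B)
      (Eventually.of_forall fun i => Continuous.aestronglyMeasurable (by fun_prop))
      (Eventually.of_forall fun i => Eventually.of_forall fun t _ => hB _)
      intervalIntegrable_const (Eventually.of_forall fun t _ => hM t)

/-- The `x`-derivative of `∫₀^y h(x - t) dt` is `h(x) - h(x - y)`; integrated against `p` it is the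
defect in the renewal equation. The flux is thus constant wherever the equation holds on an
interval. -/
theorem hasDerivAt_renewalFlux (hpi : Integrable p) (hpm : Integrable fun y => p y * y)
    (hp1 : ∫ y, p y = 1) (hh : Continuous h) (hB : ∀ x, |h x| ≤ B) (x : ℝ) :
    HasDerivAt (renewalFlux p h) (h x - ∫ y, p y * h (x - y)) x := by
  have hF : ∀ x y : ℝ, HasDerivAt (fun x => p y * ∫ t in (0 : ℝ)..y, h (x - t))
      (p y * (h x - h (x - y))) x := by
    intro x y
    have e : ∀ x, ∫ t in (0 : ℝ)..y, h (x - t) =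
        (∫ t in (0 : ℝ)..x, h t) - ∫ t in (0 : ℝ)..(x - y), h t := fun x => by
      rw [intervalIntegral.integral_comp_sub_left, sub_zero,
        intervalIntegral.integral_interval_sub_left (hh.intervalIntegrable _ _)
          (hh.intervalIntegrable _ _)]
    simp only [e]
    have h1 : ∀ x, HasDerivAt (fun x => ∫ t in (0 : ℝ)..x, h t) (h x) x := fun x =>
      hh.integral_hasStrictDerivAt 0 x |>.hasDerivAt
    exact ((h1 x).sub ((h1 (x - y)).comp_sub_const x y)).const_mul _
  have hB0 : 0 ≤ B := (abs_nonneg _).trans (hB 0)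
  have hint : Integrable fun y => p y * h (x - y) :=
    hpi.mul_bdd (c := B) (Continuous.aestronglyMeasurable (by fun_prop))
      (Eventually.of_forall fun y => hB _)
  have hmeas : ∀ x, AEStronglyMeasurable (fun y => p y * ∫ t in (0 : ℝ)..y, h (x - t)) volume :=
    fun x => hpi.aestronglyMeasurable.mul
      (continuous_intervalIntegral_comp_sub hh _).aestronglyMeasurable
  have key := hasDerivAt_integral_of_dominated_loc_of_deriv_le (μ := volume) (s := Set.univ)
    (x₀ := x) (F := fun x y => p y * ∫ t in (0 : ℝ)..y, h (x - t))
    (F' := fun x y => p y * (h x - h (x - y))) (bound := fun y => |p y| * (B + B))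
    univ_mem (Eventually.of_forall hmeas)
    ((hpm.abs.const_mul B).mono' (hmeas x) (Eventually.of_forall fun y => by
      rw [norm_mul, Real.norm_eq_abs, Real.norm_eq_abs, abs_mul, mul_left_comm]
      exact mul_le_mul_of_nonneg_left (abs_intervalIntegral_comp_sub_le hB _ _) (abs_nonneg _)))
    (hpi.aestronglyMeasurable.mul (Continuous.aestronglyMeasurable (by fun_prop)))
    (Eventually.of_forall fun y x _ => by
      rw [norm_mul, Real.norm_eq_abs, Real.norm_eq_abs]
      exact mul_le_mul_of_nonneg_left ((abs_sub _ _).trans (add_le_add (hB _) (hB _)))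
        (abs_nonneg _))
    (hpi.abs.mul_const _) (Eventually.of_forall fun y x _ => hF x y)
  have e : ∫ y, p y * (h x - h (x - y)) = h x - ∫ y, p y * h (x - y) := by
    simp only [mul_sub]
    rw [integral_sub (hpi.mul_const _) hint, integral_mul_const, hp1, one_mul]
  rw [← e]
  exact key.2

/-- The upper limit of a solution of the renewal equation is determined by its flux. -/
theorem limsup_mul_mean_eq_of_renewal_eq {Γ : ℝ}
    (hpc : Continuous p) (hp0 : ∀ y, 0 ≤ p y) (hpi : Integrable p) (hp1 : ∫ y, p y = 1)
    (hpm : Integrable fun y => p y * y) (hpos : ∃ R, 0 < R ∧ ∀ x, R ≤ |x| → 0 < p x)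
    (hh : UniformContinuous h) (hB : ∀ x, |h x| ≤ B)
    (heq : ∀ᶠ x in atTop, h x = ∫ y, p y * h (x - y))
    (hΓ : Tendsto (renewalFlux p h) atTop (𝓝 Γ)) :
    limsup h atTop * ∫ y, p y * y = Γ := by
  set M := limsup h atTop
  have hbu : IsBoundedUnder (· ≤ ·) atTop h :=
    isBoundedUnder_of ⟨B, fun x => (abs_le.1 (hB x)).2⟩
  have hbl : IsBoundedUnder (· ≥ ·) atTop h :=
    isBoundedUnder_of ⟨-B, fun x => (abs_le.1 (hB x)).1⟩
  have hup : ∀ ε, 0 < ε → ∀ᶠ x in atTop, h x < M + ε := fun ε hε =>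
    eventually_lt_of_limsup_lt (lt_add_of_pos_right M hε) hbu
  have hlo : ∀ n : ℕ, ∃ x, (n : ℝ) ≤ x ∧ M - 1 / ((n : ℝ) + 1) < h x := fun n => by
    have h1 : ∃ᶠ x in atTop, M - 1 / ((n : ℝ) + 1) < h x :=
      frequently_lt_of_lt_limsup hbl.isCoboundedUnder_le
        (sub_lt_self M (by positivity))
    obtain ⟨x, h2, h3⟩ := (h1.and_eventually (eventually_ge_atTop (n : ℝ))).exists
    exact ⟨x, h3, h2⟩
  choose x hxn hxM using hlo
  have hx : Tendsto x atTop atTop := tendsto_atTop_mono hxn tendsto_natCast_atTop_atTop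
  have hM : Tendsto (fun n => h (x n)) atTop (𝓝 M) := by
    rw [Metric.tendsto_nhds]
    intro ε hε
    have h1 : ∀ᶠ n : ℕ in atTop, 1 / ((n : ℝ) + 1) < ε :=
      tendsto_one_div_add_atTop_nhds_zero_nat.eventually (eventually_lt_nhds hε)
    filter_upwards [hx.eventually (hup ε hε), h1] with n hn1 hn2
    rw [Real.dist_eq, abs_lt]
    constructor <;> linarith [hxM n]
  exact tendsto_nhds_unique
    (tendsto_renewalFlux hpi hpm hh.continuous hB
      (tendsto_comp_sub_of_renewal_eq' hpc hp0 hpi hp1 hpos hh hB heq hup hx hM))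
    (hΓ.comp hx)

/-- Renewal theorem for a kernel with a finite first moment. -/
theorem exists_tendsto_of_renewal_eq {Γ : ℝ} (hΓ0 : 0 < Γ)
    (hpc : Continuous p) (hp0 : ∀ y, 0 ≤ p y) (hpi : Integrable p) (hp1 : ∫ y, p y = 1)
    (hpm : Integrable fun y => p y * y) (hpos : ∃ R, 0 < R ∧ ∀ x, R ≤ |x| → 0 < p x)
    (hh : UniformContinuous h) (hh0 : ∀ x, 0 ≤ h x) (hB : ∀ x, |h x| ≤ B)
    (heq : ∀ᶠ x in atTop, h x = ∫ y, p y * h (x - y))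
    (hΓ : Tendsto (renewalFlux p h) atTop (𝓝 Γ)) :
    ∃ C, 0 < C ∧ Tendsto h atTop (𝓝 C) := by
  have h1 := limsup_mul_mean_eq_of_renewal_eq hpc hp0 hpi hp1 hpm hpos hh hB heq hΓ
  have hneg : renewalFlux p (fun x => -h x) = fun x => -renewalFlux p h x := by
    ext x
    simp [renewalFlux, intervalIntegral.integral_neg, integral_neg]
  -- Applied to `-h`, the flux identity determines the lower limit of `h` as well, so the two limits
  -- coincide.
  have h2 := limsup_mul_mean_eq_of_renewal_eq (h := fun x => -h x) hpc hp0 hpi hp1 hpm hpos hh.neg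
    (by simpa using hB) (by filter_upwards [heq] with x hx; simp [hx, integral_neg])
    (by rw [hneg]; exact hΓ.neg)
  set M := limsup h atTop
  set M' := limsup (fun x => -h x) atTop
  -- The mean of the kernel is not assumed nonzero; the nonzero flux forces it.
  have hm : ∫ y, p y * y ≠ 0 := fun h0 => by
    rw [h0, mul_zero] at h1
    exact hΓ0.ne h1
  have hMM : M' = -M := by
    refine mul_right_cancel₀ hm ?_
    rw [h2, neg_mul, h1]
  have hbu : IsBoundedUnder (· ≤ ·) atTop h :=
    isBoundedUnder_of ⟨B, fun x => (abs_le.1 (hB x)).2⟩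
  have hbu' : IsBoundedUnder (· ≤ ·) atTop fun x => -h x :=
    isBoundedUnder_of ⟨B, fun x => by linarith [(abs_le.1 (hB x)).1]⟩
  have hlim : Tendsto h atTop (𝓝 M) := by
    rw [Metric.tendsto_nhds]
    intro ε hε
    filter_upwards [eventually_lt_of_limsup_lt (lt_add_of_pos_right M hε) hbu,
      eventually_lt_of_limsup_lt (lt_add_of_pos_right M' hε) hbu'] with x hx hx'
    rw [Real.dist_eq, abs_lt]
    constructor <;> linarith
  refine ⟨M, (ge_of_tendsto' hlim hh0).lt_of_ne fun h0 => ?_, hlim⟩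
  rw [← h0, zero_mul] at h1
  exact hΓ0.ne h1

end Renewal

/-! ### Sharp exponential asymptotics and the case without a critical rate. -/

section Asymptotics

variable {a V u : ℝ → ℝ} {c lam q : ℝ}

theorem integrable_mul_exp_mul_id_of_tendsto_log (ha : IsDispersalKernel a) (hc : 0 < c)
    (hlim : Tendsto (fun x : ℝ => Real.log (a x) / |x|) (cocompact ℝ) (𝓝 (-c)))
    (hq : |q| < c) : Integrable fun x => a x * Real.exp (q * x) * x := by
  obtain ⟨r, hr1, hr2⟩ := exists_between hq
  have hη : 0 < r - |q| := sub_pos.2 hr1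
  refine ((integrable_mul_exp_abs_of_tendsto_log ha hc hlim hr2).const_mul (r - |q|)⁻¹).mono'
    ((ha.continuous.mul (by fun_prop)).mul continuous_id).aestronglyMeasurable
    (Eventually.of_forall fun x => ?_)
  rw [norm_mul, Real.norm_of_nonneg (mul_nonneg (ha.nonneg x) (Real.exp_pos _).le),
    Real.norm_eq_abs, ← div_eq_inv_mul, le_div_iff₀ hη, mul_assoc, mul_assoc]
  refine mul_le_mul_of_nonneg_left ?_ (ha.nonneg x)
  have h1 : |x| * (r - |q|) ≤ Real.exp ((r - |q|) * |x|) := by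
    have := Real.add_one_le_exp ((r - |q|) * |x|)
    linarith
  calc Real.exp (q * x) * (|x| * (r - |q|))
      ≤ Real.exp (|q| * |x|) * Real.exp ((r - |q|) * |x|) := by
        refine mul_le_mul (Real.exp_le_exp.2 ?_) h1 (by positivity) (Real.exp_pos _).le
        rw [← abs_mul]
        exact le_abs_self _
    _ = Real.exp (r * |x|) := by rw [← Real.exp_add]; congr 1; ring

/-- Multiplying by `exp (q x)` turns the stationary equation into a renewal equation with kernel
`a(y) exp (q y) / (1 + lam)` and a source supported where `V` is. -/
theorem IsStationarySolution.tilted_eq (hlam : 0 < lam) (hu : IsStationarySolution a V lam u)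
    (q x : ℝ) :
    Real.exp (q * x) * u x
        - ∫ y, a y * Real.exp (q * y) / (1 + lam) * (Real.exp (q * (x - y)) * u (x - y)) =
      Real.exp (q * x) * (V x * u x) / (1 + lam) := by
  have h1 : ∀ y, a y * Real.exp (q * y) / (1 + lam) * (Real.exp (q * (x - y)) * u (x - y)) =
      Real.exp (q * x) / (1 + lam) * (a y * u (x - y)) := fun y => by
    have : Real.exp (q * x) = Real.exp (q * y) * Real.exp (q * (x - y)) := by
      rw [← Real.exp_add]; congr 1; ring
    rw [this]
    ring
  have h2 : ∫ y, a y * u (x - y) = ∫ y, a (x - y) * u y := by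
    rw [← integral_sub_left_eq_self (fun y => a y * u (x - y)) volume x]
    simp
  simp only [h1]
  rw [integral_const_mul, h2]
  have := hu.eq x
  have : (∫ y, a (x - y) * u y) = (1 + lam) * u x - V x * u x := by linarith
  rw [this]
  have : 1 + lam ≠ 0 := by linarith
  field_simp
  ring

theorem IsPotential.exists_pos (hV : IsPotential V) : ∃ x, 0 < V x := by
  by_contra! h
  exact hV.ne_zero (funext fun x => le_antisymm (h x) (hV.nonneg x))

theorem IsPotential.exists_forall_eq_zero (hV : IsPotential V) :
    ∃ R, 0 < R ∧ ∀ x, R ≤ |x| → V x = 0 := by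
  rw [← eventually_cocompact_real_iff]
  filter_upwards [hV.hasCompactSupport.isCompact.compl_mem_cocompact] with x hx
  exact image_eq_zero_of_notMem_tsupport hx

theorem IsStationarySolution.exists_tendsto_exp_mul_atTop (hlam : 0 < lam)
    (ha : IsDispersalKernel a) (hV : IsPotential V) (hu : IsStationarySolution a V lam u)
    (hc : 0 < c)
    (hlim : Tendsto (fun x : ℝ => Real.log (a x) / |x|) (cocompact ℝ) (𝓝 (-c)))
    (hq0 : 0 < q) (hqc : q < c) (hq : ∫ x, a x * Real.exp (q * x) = 1 + lam) :
    ∃ C, 0 < C ∧ Tendsto (fun x => Real.exp (q * x) * u x) atTop (𝓝 C) := by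
  have hqa : |q| < c := by rwa [abs_of_pos hq0]
  have hl1 : 0 < 1 + lam := by linarith
  have hkpos := exists_forall_pos_of_tendsto_log ha hc hlim
  have hup := hu.pos ha hkpos
  have huc := hu.continuous
  have hac := ha.continuous
  have hVc := hV.continuous
  have hI := integrable_mul_exp_of_tendsto_log ha hc hlim hqa
  obtain ⟨B, hB0, hB⟩ := hu.exists_le_exp_mul hlam ha hV hI hq.le
  obtain ⟨D, hD⟩ := hu.bounded
  obtain ⟨R, hR, hVR⟩ := hV.exists_forall_eq_zero
  set p : ℝ → ℝ := fun y => a y * Real.exp (q * y) / (1 + lam) with hp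
  set h : ℝ → ℝ := fun x => Real.exp (q * x) * u x with hh
  set g : ℝ → ℝ := fun x => Real.exp (q * x) * (V x * u x) / (1 + lam) with hg
  have hgc : Continuous g := by fun_prop
  have hhc : Continuous h := by fun_prop
  have hpi : Integrable p := hI.div_const _
  have hp1 : ∫ y, p y = 1 := by
    simp only [hp]
    rw [integral_div, hq, div_self hl1.ne']
  have hpm : Integrable fun y => p y * y := by
    refine ((integrable_mul_exp_mul_id_of_tendsto_log ha hc hlim hqa).div_const (1 + lam)).congr
      (Eventually.of_forall fun y => ?_)
    simp only [hp]
    ring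
  have hh0 : ∀ x, 0 ≤ h x := fun x => mul_nonneg (Real.exp_pos _).le (hu.nonneg x)
  have hhB : ∀ x, |h x| ≤ B := fun x => by
    rw [abs_of_nonneg (hh0 x)]
    have := hB x
    rwa [Real.exp_neg, ← div_eq_mul_inv, le_div_iff₀ (Real.exp_pos _), mul_comm] at this
  have hg0 : ∀ x, 0 ≤ g x := fun x =>
    div_nonneg (mul_nonneg (Real.exp_pos _).le (mul_nonneg (hV.nonneg x) (hu.nonneg x))) hl1.le
  have hgR : ∀ x, R ≤ |x| → g x = 0 := fun x hx => by simp [hg, hVR x hx]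
  have heq : ∀ x, h x - ∫ y, p y * h (x - y) = g x := fun x => hu.tilted_eq hlam q x
  have hgs : HasCompactSupport g := by
    refine hV.hasCompactSupport.mono fun x hx hx' => hx ?_
    simp [hg, hx']
  have hhu : UniformContinuous h := by
    have : h = fun x => (∫ y, p y * h (x - y)) + g x := funext fun x => by linarith [heq x]
    rw [this]
    exact (uniformContinuous_integral_mul_comp_sub hpi hhc hhB).add
      (hgs.uniformContinuous_of_continuous hgc)
  have hder : ∀ x, HasDerivAt (renewalFlux p h) (g x) x := fun x => by
    rw [← heq x]
    exact hasDerivAt_renewalFlux hpi hpm hp1 hhc hhB x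
  have hFTC : ∀ x y, ∫ t in x..y, g t = renewalFlux p h y - renewalFlux p h x := fun x y =>
    intervalIntegral.integral_eq_sub_of_hasDerivAt (fun t _ => hder t)
      (hgc.intervalIntegrable _ _)
  have htop : ∀ x, R ≤ x → renewalFlux p h x = renewalFlux p h R := fun x hx => by
    have h1 : ∫ t in R..x, g t = ∫ t in R..x, (0 : ℝ) :=
      intervalIntegral.integral_congr fun t ht => by
        rw [Set.uIcc_of_le hx] at ht
        exact hgR t (ht.1.trans (le_abs_self t))
    rw [hFTC, intervalIntegral.integral_zero] at h1
    linarith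
  have hbot : ∀ x, x ≤ -R → renewalFlux p h x = renewalFlux p h (-R) := fun x hx => by
    have h1 : ∫ t in x..(-R), g t = ∫ t in x..(-R), (0 : ℝ) :=
      intervalIntegral.integral_congr fun t ht => by
        rw [Set.uIcc_of_le hx] at ht
        exact hgR t (le_trans (by linarith [ht.2]) (neg_le_abs t))
    rw [hFTC, intervalIntegral.integral_zero] at h1
    linarith
  -- Boundedness of `u` is enough, since `exp (q x) → 0` on the left. The flux, constant to the left
  -- of `-R`, is therefore `0` there.
  have hhbot : Tendsto h atBot (𝓝 0) := by
    have h1 : Tendsto (fun x : ℝ => Real.exp (q * x) * D) atBot (𝓝 (0 * D)) :=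
      (Real.tendsto_exp_atBot.comp (tendsto_id.const_mul_atBot hq0)).mul_const D
    rw [zero_mul] at h1
    exact squeeze_zero hh0 (fun x => mul_le_mul_of_nonneg_left (hD x) (Real.exp_pos _).le) h1
  have hflux0 : renewalFlux p h (-R) = 0 := by
    have h1 := tendsto_renewalFlux (l := atBot) (x := fun x => x) (M := 0) hpi hpm hhc hhB
      fun t => hhbot.comp (tendsto_atBot_add_const_right _ (-t) tendsto_id)
    rw [zero_mul] at h1
    refine tendsto_nhds_unique (tendsto_const_nhds.congr' ?_) h1
    filter_upwards [eventually_le_atBot (-R)] with x hx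
    exact (hbot x hx).symm
  -- The flux gained across `[-R, R]` is the integral of `g`, positive because `u > 0` and `V` is
  -- positive somewhere.
  have hΓ : 0 < renewalFlux p h R := by
    have h1 := hFTC (-R) R
    rw [hflux0, sub_zero] at h1
    rw [← h1]
    obtain ⟨x, hx⟩ := hV.exists_pos
    refine intervalIntegral.integral_pos (by linarith) hgc.continuousOn (fun x _ => hg0 x)
      ⟨x, ?_, div_pos (mul_pos (Real.exp_pos _) (mul_pos hx (hup x))) hl1⟩
    rw [Set.mem_Icc, ← abs_le]
    by_contra! hcon
    exact hx.ne' (hVR x hcon.le)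
  refine exists_tendsto_of_renewal_eq hΓ (by fun_prop)
    (fun y => div_nonneg (mul_nonneg (ha.nonneg y) (Real.exp_pos _).le) hl1.le) hpi hp1 hpm ?_
    hhu hh0 hhB ?_ ?_
  · obtain ⟨R', hR', hpos⟩ := hkpos
    exact ⟨R', hR', fun x hx => div_pos (mul_pos (hpos x hx) (Real.exp_pos _)) hl1⟩
  · filter_upwards [eventually_ge_atTop R] with x hx
    have := heq x
    rw [hgR x (hx.trans (le_abs_self x))] at this
    linarith
  · refine tendsto_const_nhds.congr' ?_
    filter_upwards [eventually_ge_atTop R] with x hx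
    exact (htop x hx).symm

theorem IsStationarySolution.exists_tendsto_exp_abs (hlam : 0 < lam)
    (ha : IsDispersalKernel a) (hV : IsPotential V) (hu : IsStationarySolution a V lam u)
    (hc : 0 < c)
    (hlim : Tendsto (fun x : ℝ => Real.log (a x) / |x|) (cocompact ℝ) (𝓝 (-c)))
    (hq0 : 0 < q) (hqc : q < c) (hq : ∫ x, a x * Real.exp (q * x) = 1 + lam) :
    ∃ Cp Cm : ℝ, 0 < Cp ∧ 0 < Cm ∧
      Tendsto (fun x : ℝ => Real.exp (q * |x|) * u x) atTop (𝓝 Cp) ∧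
      Tendsto (fun x : ℝ => Real.exp (q * |x|) * u x) atBot (𝓝 Cm) ∧
      ((∀ x, V (-x) = V x) → Cp = Cm) := by
  obtain ⟨Cp, hCp, hp⟩ := hu.exists_tendsto_exp_mul_atTop hlam ha hV hc hlim hq0 hqc hq
  obtain ⟨Cm, hCm, hm⟩ := (hu.comp_neg ha).exists_tendsto_exp_mul_atTop hlam ha hV.comp_neg hc
    hlim hq0 hqc hq
  refine ⟨Cp, Cm, hCp, hCm, ?_, ?_, fun hVe => ?_⟩
  · refine hp.congr' ?_
    filter_upwards [eventually_ge_atTop 0] with x hx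
    rw [abs_of_nonneg hx]
  · refine (hm.comp tendsto_neg_atBot_atTop).congr' ?_
    filter_upwards [eventually_le_atBot 0] with x hx
    simp [abs_of_nonpos hx]
  · simp only [hu.comp_neg_eq hlam ha (exists_forall_pos_of_tendsto_log ha hc hlim) hV hVe] at hm
    exact tendsto_nhds_unique hp hm

theorem IsStationarySolution.exists_exp_bounds_of_forall_ne (hlam : 0 < lam)
    (ha : IsDispersalKernel a) (hV : IsPotential V) (hu : IsStationarySolution a V lam u)
    (hc : 0 < c)
    (hlim : Tendsto (fun x : ℝ => Real.log (a x) / |x|) (cocompact ℝ) (𝓝 (-c)))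
    (hne : ∀ q, 0 < q → q < c → ∫ x, a x * Real.exp (q * x) ≠ 1 + lam) {ε : ℝ} (hε : 0 < ε) :
    ∃ C₁ C₂ : ℝ, 0 < C₁ ∧ 0 < C₂ ∧ ∀ x : ℝ, C₁ * Real.exp (-((c + ε) * |x|)) ≤ u x ∧
      u x ≤ C₂ * Real.exp (-((c - ε) * |x|)) := by
  obtain ⟨C₁, hC₁, h₁⟩ := hu.exists_exp_le hlam ha hV hc hlim (lt_add_of_pos_right c hε)
  -- The rate must exceed `c - ε` and also be positive, as `ε` may be larger than `c`.
  obtain ⟨q, hq1, hqc⟩ := exists_between (max_lt (sub_lt_self c hε) hc)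
  have hq0 : 0 < q := (le_max_right _ _).trans_lt hq1
  obtain ⟨C₂, hC₂, h₂⟩ := hu.exists_le_exp_abs hlam ha hV hc hlim hq0 hqc
    (integral_mul_exp_lt_of_forall_ne ha hc hlim hlam hne hq0 hqc).le
  refine ⟨C₁, C₂, hC₁, hC₂, fun x => ⟨h₁ x, (h₂ x).trans ?_⟩⟩
  refine mul_le_mul_of_nonneg_left (Real.exp_le_exp.2 (neg_le_neg ?_)) hC₂.le
  exact mul_le_mul_of_nonneg_right ((le_max_left _ _).trans_lt hq1).le (abs_nonneg x)

end Asymptotics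

theorem theorem3p2 (lam : ℝ) (hlam : 0 < lam) :
    -- polynomially decaying kernels
    (∀ (d : ℕ), 1 ≤ d → ∀ a : EuclideanSpace ℝ (Fin d) → ℝ, IsDispersalKernel a →
      ∀ α cm cp : ℝ, 0 < α → 0 < cm →
      (∀ x, cm * (1 + ‖x‖) ^ (-((d : ℝ) + α)) ≤ a x ∧
        a x ≤ cp * (1 + ‖x‖) ^ (-((d : ℝ) + α))) →
      ∀ V ψ : EuclideanSpace ℝ (Fin d) → ℝ, IsPotential V →
      IsPrincipalEigenfunction a V lam ψ →
      ∃ φ : EuclideanSpace ℝ (Fin d) → ℝ, Continuous φ ∧ φ =ᵐ[volume] ψ ∧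
        ∃ c₁ c₂ : ℝ, 0 < c₁ ∧ c₁ ≤ c₂ ∧
          ∀ x, c₁ * (1 + ‖x‖) ^ (-((d : ℝ) + α)) ≤ φ x ∧
            φ x ≤ c₂ * (1 + ‖x‖) ^ (-((d : ℝ) + α))) ∧
    -- exponentially bounded kernels; the rate depends on the kernel and the eigenvalue only
    (∀ (d : ℕ), 1 ≤ d → ∀ a : EuclideanSpace ℝ (Fin d) → ℝ, IsDispersalKernel a →
      ∀ c δ : ℝ, 0 < δ → (∀ x, a x ≤ c * Real.exp (-(δ * ‖x‖))) →
      ∃ m : ℝ, 0 < m ∧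
        ∀ V ψ : EuclideanSpace ℝ (Fin d) → ℝ, IsPotential V →
        IsPrincipalEigenfunction a V lam ψ →
        ∃ φ : EuclideanSpace ℝ (Fin d) → ℝ, Continuous φ ∧ φ =ᵐ[volume] ψ ∧
          ∃ K : ℝ, 0 < K ∧ ∀ x, φ x ≤ K * Real.exp (-(m * ‖x‖))) ∧
    -- dimension one
    (∀ a : ℝ → ℝ, IsDispersalKernel a →
      ∀ c : ℝ, 0 < c →
      Tendsto (fun x : ℝ => Real.log (a x) / |x|) (cocompact ℝ) (𝓝 (-c)) →
      ∀ V ψ : ℝ → ℝ, IsPotential V → IsPrincipalEigenfunction a V lam ψ →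
      ∃ φ : ℝ → ℝ, Continuous φ ∧ φ =ᵐ[volume] ψ ∧
        (∀ q : ℝ, 0 < q → q < c → kernelTransform a (Complex.I * (q : ℂ)) = 1 + (lam : ℂ) →
          ∃ Cp Cm : ℝ, 0 < Cp ∧ 0 < Cm ∧
            Tendsto (fun x : ℝ => Real.exp (q * |x|) * φ x) atTop (𝓝 Cp) ∧
            Tendsto (fun x : ℝ => Real.exp (q * |x|) * φ x) atBot (𝓝 Cm) ∧
            ((∀ x, V (-x) = V x) → Cp = Cm)) ∧
        ((¬ ∃ q : ℝ, 0 < q ∧ q < c ∧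
            kernelTransform a (Complex.I * (q : ℂ)) = 1 + (lam : ℂ)) →
          ∀ ε : ℝ, 0 < ε → ∃ C₁ C₂ : ℝ, 0 < C₁ ∧ 0 < C₂ ∧
            ∀ x : ℝ, C₁ * Real.exp (-((c + ε) * |x|)) ≤ φ x ∧
              φ x ≤ C₂ * Real.exp (-((c - ε) * |x|)))) := by
  refine ⟨fun d _ a ha α cm cp hα hcm hbd V ψ hV hψ => ?_, fun d _ a ha c δ hδ hle => ?_,
    fun a ha c hc hlim V ψ hV hψ => ?_⟩
  · obtain ⟨u, hae, hu⟩ := hψ.exists_isStationarySolution hlam ha hV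
    exact ⟨u, hu.continuous, hae, hu.exists_polynomial_bounds hlam ha hV
      (by rw [finrank_euclideanSpace_fin]; linarith) hcm (fun x => (hbd x).1) fun x => (hbd x).2⟩
  -- The rate is fixed before `V` and `ψ` are introduced.
  · obtain ⟨m, hm, hmδ, hmle⟩ := ha.exists_exp_moment_le hlam hδ hle
    refine ⟨m, hm, fun V ψ hV hψ => ?_⟩
    obtain ⟨u, hae, hu⟩ := hψ.exists_isStationarySolution hlam ha hV
    exact ⟨u, hu.continuous, hae, hu.exists_le_exp_norm hlam ha hV hm
      (ha.integrable_mul_exp_norm hmδ hle) hmle⟩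
  · obtain ⟨u, hae, hu⟩ := hψ.exists_isStationarySolution hlam ha hV
    simp only [kernelTransform_I_mul_eq_iff]
    exact ⟨u, hu.continuous, hae,
      fun q hq0 hqc hq => hu.exists_tendsto_exp_abs hlam ha hV hc hlim hq0 hqc hq,
      fun hne ε hε => hu.exists_exp_bounds_of_forall_ne hlam ha hV hc hlim
        (fun q h0 h1 h2 => hne ⟨q, h0, h1, h2⟩) hε⟩
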